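/- Let $G=\frac{1+\sqrt5}{2}$ and $g=\frac{\sqrt5-1}{2}$. For $\alpha\in[g,G]$ let $I_\alpha=[\alpha-2,\alpha)$ and define, for $x\in I_\alpha\setminus\{0\}$, $$d_\alpha(x)=2\left\lfloor \frac{1}{2|x|}+\frac{1-\alpha}{2}\right\rfloor+1,\qquad e(x)=\operatorname{sign}(x),\qquad \varphi_\alpha(x)=\frac1{|x|}-d_\alpha(x),$$ and $\varphi_\alpha(0)=0$. For irrational $x\in I_\alpha$ and $i\ge 1$ put $d_i=d_\alpha(\varphi_\alpha^{i-1}(x))$ and $e_i=e(\varphi_\alpha^{i-1}(x))$, and define integers $p_n=p_n(x;\alpha)$, $q_n=q_n(x;\alpha)$ by $p_0=0$, $p_1=e_1$, $q_0=1$, $q_1=d_1$ and, for $n\ge2$, $$p_n=d_np_{n-1}+e_np_{n-2},\qquad q_n=d_nq_{n-1}+e_nq_{n-2}.$$ Then for every $\alpha\in[g,G]$ and Lebesgue-almost every irrational $x\in I_\alpha$ one has $q_n>0$ for all $n\ge 0$, and (i) $\displaystyle\lim_{n\to\infty}\frac1n\log|q_nx-p_n|=-\frac{\pi^2}{18\log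 G}$; (ii) $\displaystyle\lim_{n\to\infty}\frac1n\log q_n=\frac{\pi^2}{18\log G}$; (iii) $\displaystyle\lim_{n\to\infty}\frac1n\log\left|x-\frac{p_n}{q_n}\right|=-\frac{\pi^2}{9\log G}$. -/

import Mathlib

/-- The interval `I_α = [α - 2, α)`. -/
def ocfInterval (α : ℝ) : Set ℝ := Set.Ico (α - 2) α

/-- The odd digit function `d_α(x) = 2 ⌊1 / (2|x|) + (1 - α) / 2⌋ + 1`, used only for `x ≠ 0`. -/
noncomputable def ocfD (α x : ℝ) : ℤ := 2 * ⌊1 / (2 * |x|) + (1 - α) / 2⌋ + 1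

/-- The sign function `e(x) = sign x`. -/
noncomputable def ocfE (x : ℝ) : ℤ := (SignType.sign x : ℤ)

open Classical in
/-- The Gauss map `φ_α`: `φ_α(0) = 0` and `φ_α(x) = 1 / |x| - d_α(x)` for `x ≠ 0`. -/
noncomputable def ocfMap (α x : ℝ) : ℝ := if x = 0 then 0 else 1 / |x| - (ocfD α x : ℝ)

/-- The digit `d_i(x; α) = d_α(φ_α^{i-1}(x))`, for `i ≥ 1`. -/
noncomputable def ocfDigit (α x : ℝ) (i : ℕ) : ℤ := ocfD α ((ocfMap α)^[i - 1] x)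

/-- The sign `e_i(x; α) = e(φ_α^{i-1}(x))`, for `i ≥ 1`. -/
noncomputable def ocfSign (α x : ℝ) (i : ℕ) : ℤ := ocfE ((ocfMap α)^[i - 1] x)

/-- The numerators: `p_0 = 0`, `p_1 = e_1`, `p_n = d_n p_{n-1} + e_n p_{n-2}` for `n ≥ 2`. -/
noncomputable def ocfNum (α x : ℝ) : ℕ → ℤ
  | 0 => 0
  | 1 => ocfSign α x 1
  | n + 2 => ocfDigit α x (n + 2) * ocfNum α x (n + 1) + ocfSign α x (n + 2) * ocfNum α x n

/-- The denominators: `q_0 = 1`, `q_1 = d_1`, `q_n = d_n q_{n-1} + e_n q_{n-2}` for `n ≥ 2`. -/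
noncomputable def ocfDen (α x : ℝ) : ℕ → ℤ
  | 0 => 1
  | 1 => ocfDigit α x 1
  | n + 2 => ocfDigit α x (n + 2) * ocfDen α x (n + 1) + ocfSign α x (n + 2) * ocfDen α x n

/-! The case `α = 1` is done by ergodic theory; every other parameter is then tied to it by a
deterministic coupling with bounded multiplicative error.

For `α = 1` write `x_n` for the orbit and `s_n = q_n x - p_n`. Then `s_n = -x_n s_{n-1}`, so `log
|s_{n-1}|` is the sum of `log |x_i|` over `i < n`, a Birkhoff sum for the folded map `u ↦ |φ_1(u)|`
on `(0,1)` (`log_abs_eq_birkhoffSum`). That map preserves the density `1/(u+g) + 1/(G²-u)`, by a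
telescoping sum over its inverse branches (`measurePreserving_oddFold`), and is ergodic, since its
inverse branches have bounded distortion and a Lebesgue density argument applies
(`ergodic_oddFold`). The density has mass `3 log G`, and its integral against `log u` is `-π²/6`, a
dilogarithm evaluation made possible by `g² + g = 1`. The quotient is the constant `-π²/(18 log G)`.
The identity `|s_{n-1}| (q_n + x_n q_{n-1}) = 1` (`ocfStep_iterate_det`), whose second factor is
comparable to `q_n`, turns this into the growth rate of `q_n`.

For `α` in `[g, G]`, the `α`-orbit of `x` follows the `1`-orbit of one of `x`, `x ± 2`. At each time
the pair of states is in one of finitely many relations (`OcfRelLow`, `OcfRelHigh`), under which the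
`α`-term is `s_n`, `s_n + 2 s_{n-1}` or `s_n - 2 s_{n-1}` in terms of the `1`-expansion, and
likewise for denominators. The last two cases occur only when `x_n` is away from `0` and has a known
sign, so ratios of corresponding terms stay between positive constants and the exponential rates
agree. Limit (iii) is the difference of (i) and (ii). -/

/-! ### Birkhoff's ergodic theorem, from a maximal inequality. -/

section Birkhoff

open MeasureTheory Filter Topology

variable {X : Type*}

/-- The running maximum of the Birkhoff sums of length `1, …, n + 1`. -/
noncomputable def birkhoffMax (T : X → X) (f : X → ℝ) : ℕ → X → ℝ
  | 0 => f
  | n + 1 => fun x => f x + max 0 (birkhoffMax T f n (T x))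

theorem birkhoffMax_le_succ (T : X → X) (f : X → ℝ) (n : ℕ) :
    ∀ x, birkhoffMax T f n x ≤ birkhoffMax T f (n + 1) x := by
  induction n with
  | zero => intro x; simp [birkhoffMax]
  | succ n ih =>
    intro x
    have := ih (T x)
    simp only [birkhoffMax] at this ⊢
    gcongr

theorem birkhoffMax_monotone (T : X → X) (f : X → ℝ) (x : X) :
    Monotone fun n => birkhoffMax T f n x :=
  monotone_nat_of_le_succ fun n => birkhoffMax_le_succ T f n x

theorem birkhoffSum_le_birkhoffMax (T : X → X) (f : X → ℝ) (n : ℕ) :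
    ∀ x, birkhoffSum T f (n + 1) x ≤ birkhoffMax T f n x := by
  induction n with
  | zero => intro x; simp [birkhoffMax]
  | succ n ih =>
    intro x
    rw [birkhoffSum_succ']
    simp only [birkhoffMax]
    gcongr
    exact (ih _).trans (le_max_right _ _)

variable [MeasurableSpace X] {μ : Measure X} {T : X → X} {f : X → ℝ}

theorem measurable_birkhoffMax (hT : Measurable T) (hf : Measurable f) (n : ℕ) :
    Measurable (birkhoffMax T f n) := by
  induction n with
  | zero => exact hf
  | succ n ih => exact hf.add (measurable_const.max (ih.comp hT))

theorem integrable_birkhoffMax (hT : MeasurePreserving T μ μ) (hf : Integrable f μ) (n : ℕ) :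
    Integrable (birkhoffMax T f n) μ := by
  induction n with
  | zero => exact hf
  | succ n ih =>
    refine hf.add ?_
    have := (hT.integrable_comp_of_integrable ih).pos_part
    refine this.congr (Eventually.of_forall fun x => ?_)
    exact max_comm _ _

/-- For an ergodic map, the Birkhoff sums of a function of negative mean are almost surely
bounded above. -/
theorem Ergodic.ae_bddAbove_birkhoffSum [IsFiniteMeasure μ] (hT : Ergodic T μ)
    (hfm : Measurable f) (hf : Integrable f μ) (hneg : ∫ x, f x ∂μ < 0) :
    ∀ᵐ x ∂μ, ∃ C : ℝ, ∀ n, birkhoffSum T f n x ≤ C := by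
  have hTm := hT.toMeasurePreserving
  -- The set where the maximal sums are unbounded is invariant, hence null or conull. The integral
  -- of `f` over it turns out to be nonnegative, which rules out conull.
  set A : Set X := {x | ∀ k : ℕ, ∃ n, (k : ℝ) < birkhoffMax T f n x} with hA
  have hAm : MeasurableSet A := by
    have : A = ⋂ k : ℕ, ⋃ n, {x | (k : ℝ) < birkhoffMax T f n x} := by
      ext x; simp [hA]
    rw [this]
    exact MeasurableSet.iInter fun k => MeasurableSet.iUnion fun n =>
      measurableSet_lt measurable_const (measurable_birkhoffMax hTm.measurable hfm n)
  have hAinv : T ⁻¹' A = A := by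
    ext x
    simp only [hA, Set.mem_preimage, Set.mem_ofPred_eq]
    constructor
    · intro h k
      obtain ⟨m, hm⟩ := exists_nat_gt (k - f x)
      obtain ⟨n, hn⟩ := h m
      refine ⟨n + 1, ?_⟩
      have := le_max_right 0 (birkhoffMax T f n (T x))
      simp only [birkhoffMax]
      linarith
    · intro h k
      obtain ⟨m, hm⟩ := exists_nat_gt (k + f x)
      obtain ⟨n, hn⟩ := h m
      refine ⟨n, ?_⟩
      have h1 := hn.trans_le (birkhoffMax_le_succ T f n x)
      simp only [birkhoffMax] at h1
      have h2 : (k : ℝ) < max 0 (birkhoffMax T f n (T x)) := by linarith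
      rcases lt_max_iff.1 h2 with h | h
      · exact absurd h (not_lt.2 k.cast_nonneg)
      · exact h
  have hAT : MeasurePreserving T (μ.restrict A) (μ.restrict A) := by
    have := hTm.restrict_preimage hAm
    rwa [hAinv] at this
  -- The integrand is `f` plus the negative part of `birkhoffMax T f n (T x)`. On `A` the negative
  -- part vanishes for large `n`, and it is at most `|f (T x)|` because the maxima dominate `f`.
  have hlim : Tendsto (fun n => ∫ x in A, (birkhoffMax T f (n + 1) x - birkhoffMax T f n (T x)) ∂μ)
      atTop (𝓝 (∫ x in A, f x ∂μ)) := by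
    refine tendsto_integral_of_dominated_convergence (fun x => |f x| + |f (T x)|) ?_ ?_ ?_ ?_
    · intro n
      exact ((measurable_birkhoffMax hTm.measurable hfm (n + 1)).sub
        ((measurable_birkhoffMax hTm.measurable hfm n).comp hTm.measurable)).aestronglyMeasurable
    · exact (hf.abs.add (hTm.integrable_comp_of_integrable hf).abs).restrict
    · intro n
      refine Eventually.of_forall fun x => ?_
      have h0 : f (T x) ≤ birkhoffMax T f n (T x) := birkhoffMax_monotone T f (T x) (Nat.zero_le n)
      simp only [birkhoffMax, Real.norm_eq_abs]
      rw [add_sub_assoc]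
      refine (abs_add_le _ _).trans (add_le_add_right ?_ _)
      rcases le_total 0 (birkhoffMax T f n (T x)) with h | h
      · simp [h]
      · rw [max_eq_left h, zero_sub, abs_neg, abs_of_nonpos h, abs_of_nonpos (h0.trans h)]
        linarith
    · rw [ae_restrict_iff' hAm]
      refine Eventually.of_forall fun x hx => ?_
      rw [← hAinv] at hx
      obtain ⟨n, hn⟩ := hx 0
      refine tendsto_const_nhds.congr' ?_
      filter_upwards [eventually_ge_atTop n] with m hm
      have : 0 ≤ birkhoffMax T f m (T x) := by
        have := birkhoffMax_monotone T f (T x) hm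
        simp only [Nat.cast_zero] at hn this
        linarith
      simp [birkhoffMax, this]
  have hnonneg : 0 ≤ ∫ x in A, f x ∂μ := by
    refine ge_of_tendsto' hlim fun n => ?_
    have i1 := (integrable_birkhoffMax hTm hf (n + 1)).restrict (s := A)
    have i0 := (integrable_birkhoffMax hTm hf n).restrict (s := A)
    -- By invariance of `A`, composing with `T` does not change the integral, so the quantity in
    -- `hlim` is the integral of an increment of an increasing sequence.
    have e : ∫ x in A, birkhoffMax T f n (T x) ∂μ = ∫ x in A, birkhoffMax T f n x ∂μ := by
      have := integral_map (μ := μ.restrict A) hAT.measurable.aemeasurable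
        (f := birkhoffMax T f n)
        (measurable_birkhoffMax hTm.measurable hfm n).aestronglyMeasurable
      rw [hAT.map_eq] at this
      exact this.symm
    have i2 : Integrable (fun x => birkhoffMax T f n (T x)) (μ.restrict A) :=
      hAT.integrable_comp_of_integrable i0
    rw [integral_sub i1 i2, e, sub_nonneg]
    exact integral_mono i0 i1 fun x => birkhoffMax_le_succ T f n x
  have hnull : ∀ᵐ x ∂μ, x ∉ A := by
    rcases hT.ae_empty_or_univ hAm hAinv with h | h
    · exact eventuallyEq_empty.1 h
    · exfalso
      rw [setIntegral_congr_set h, setIntegral_univ] at hnonneg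
      linarith
  filter_upwards [hnull] with x hx
  simp only [hA, Set.mem_ofPred_eq, not_forall, not_exists, not_lt] at hx
  obtain ⟨k, hk⟩ := hx
  refine ⟨k, fun n => ?_⟩
  cases n with
  | zero => simp
  | succ n => exact (birkhoffSum_le_birkhoffMax T f n x).trans (hk n)

/-- **Birkhoff's ergodic theorem** for ergodic maps of a probability space. -/
theorem Ergodic.ae_tendsto_birkhoffSum_div [IsProbabilityMeasure μ] (hT : Ergodic T μ)
    (hfm : Measurable f) (hf : Integrable f μ) :
    ∀ᵐ x ∂μ, Tendsto (fun n : ℕ => (1 / (n : ℝ)) * birkhoffSum T f n x) atTop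
      (𝓝 (∫ x, f x ∂μ)) := by
  set I := ∫ x, f x ∂μ with hI
  -- Shifting `f` by slightly more than its mean makes the mean negative. Bounded sums of the
  -- shifted functions, above and below, pin the averages to within `1/(k+1) + C/n`.
  have hup : ∀ᵐ x ∂μ, ∀ k : ℕ, ∃ C : ℝ, ∀ n,
      birkhoffSum T (fun x => f x - (I + 1 / ((k : ℝ) + 1))) n x ≤ C := by
    refine ae_all_iff.2 fun k => ?_
    refine hT.ae_bddAbove_birkhoffSum (hfm.sub_const _) (hf.sub (integrable_const _)) ?_
    rw [integral_sub hf (integrable_const _)]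
    have : (0 : ℝ) < 1 / ((k : ℝ) + 1) := by positivity
    simp [← hI]
    positivity
  have hlo : ∀ᵐ x ∂μ, ∀ k : ℕ, ∃ C : ℝ, ∀ n,
      birkhoffSum T (fun x => (I - 1 / ((k : ℝ) + 1)) - f x) n x ≤ C := by
    refine ae_all_iff.2 fun k => ?_
    refine hT.ae_bddAbove_birkhoffSum (hfm.const_sub _) ((integrable_const _).sub hf) ?_
    rw [integral_sub (integrable_const _) hf]
    have : (0 : ℝ) < 1 / ((k : ℝ) + 1) := by positivity
    simp [← hI]
    positivity
  filter_upwards [hup, hlo] with x hx1 hx2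
  rw [Metric.tendsto_atTop]
  intro ε hε
  obtain ⟨k, hk⟩ := exists_nat_one_div_lt (half_pos hε)
  obtain ⟨C₁, h1⟩ := hx1 k
  obtain ⟨C₂, h2⟩ := hx2 k
  obtain ⟨N, hN⟩ := exists_nat_gt (2 * max C₁ C₂ / ε)
  refine ⟨N + 1, fun n hn => ?_⟩
  have hn0 : (0 : ℝ) < n := by exact_mod_cast (Nat.succ_pos N).trans_le hn
  have hNn : (N : ℝ) < n := by exact_mod_cast hn
  have hC : max C₁ C₂ < n * (ε / 2) := by
    have := hN.trans hNn
    rw [div_lt_iff₀ hε] at this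
    linarith
  have e1 := h1 n
  have e2 := h2 n
  simp only [birkhoffSum, Finset.sum_sub_distrib, Finset.sum_const, Finset.card_range,
    nsmul_eq_mul] at e1 e2
  have m1 := (le_max_left C₁ C₂).trans_lt hC
  have m2 := (le_max_right C₁ C₂).trans_lt hC
  have hk' : (n : ℝ) * (1 / ((k : ℝ) + 1)) < n * (ε / 2) := mul_lt_mul_of_pos_left hk hn0
  rw [Real.dist_eq, abs_lt]
  have hs : 1 / (n : ℝ) * birkhoffSum T f n x - I = (birkhoffSum T f n x - n * I) / n := by
    field_simp
  rw [hs, lt_div_iff₀ hn0, div_lt_iff₀ hn0]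
  simp only [birkhoffSum]
  constructor <;> nlinarith

end Birkhoff

/-! ### The dilogarithm and the integral of `log` against the invariant density. -/

section Dilogarithm

open MeasureTheory Filter Topology Set

/-- The dilogarithm `Li₂(x) = ∑ xⁿ / n²`, used for `0 ≤ x ≤ 1`. -/
noncomputable def dilog (x : ℝ) : ℝ := ∑' n : ℕ, x ^ (n + 1) / ((n : ℝ) + 1) ^ 2

theorem summable_one_div_succ_sq : Summable fun n : ℕ => 1 / ((n : ℝ) + 1) ^ 2 := by
  have := (summable_nat_add_iff 1).2 hasSum_zeta_two.summable
  simpa using this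

theorem continuousOn_dilog : ContinuousOn dilog (Icc 0 1) := by
  refine continuousOn_tsum (u := fun n : ℕ => 1 / ((n : ℝ) + 1) ^ 2) ?_ summable_one_div_succ_sq ?_
  · intro n; fun_prop
  · intro n x hx
    rw [Real.norm_eq_abs, abs_of_nonneg (div_nonneg (pow_nonneg hx.1 _) (by positivity))]
    gcongr
    exact pow_le_one₀ hx.1 hx.2

theorem dilog_zero : dilog 0 = 0 := by simp [dilog]

theorem dilog_one : dilog 1 = Real.pi ^ 2 / 6 := by
  have h := hasSum_zeta_two
  have h2 := (hasSum_nat_add_iff' 1).2 h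
  simp only [Finset.range_one, Finset.sum_singleton, Nat.cast_zero] at h2
  norm_num at h2
  simpa [dilog] using h2.tsum_eq

theorem hasDerivAt_dilog {x : ℝ} (hx : x ∈ Ioo (0 : ℝ) 1) :
    HasDerivAt dilog (-Real.log (1 - x) / x) x := by
  obtain ⟨r, hxr, hr1⟩ := exists_between hx.2
  have hr0 : 0 < r := hx.1.trans hxr
  have key : HasDerivAt dilog (∑' n : ℕ, x ^ n / ((n : ℝ) + 1)) x := by
    refine hasDerivAt_tsum_of_isPreconnected (u := fun n : ℕ => r ^ n) (t := Ioo 0 r)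
      (g := fun (n : ℕ) (y : ℝ) => y ^ (n + 1) / ((n : ℝ) + 1) ^ 2)
      (g' := fun (n : ℕ) (y : ℝ) => y ^ n / ((n : ℝ) + 1))
      (summable_geometric_of_lt_one hr0.le hr1) isOpen_Ioo isPreconnected_Ioo ?_ ?_
      (y₀ := x) ⟨hx.1, hxr⟩ ?_ ⟨hx.1, hxr⟩
    · intro n y _
      have := (hasDerivAt_pow (n + 1) y).div_const (((n : ℝ) + 1) ^ 2)
      refine this.congr_deriv ?_
      have : (n : ℝ) + 1 ≠ 0 := by positivity
      push_cast
      field_simp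
    · intro n y hy
      rw [Real.norm_eq_abs, abs_of_nonneg (div_nonneg (pow_nonneg hy.1.le _) (by positivity))]
      calc y ^ n / ((n : ℝ) + 1) ≤ y ^ n / 1 := by
            gcongr
            · exact pow_nonneg hy.1.le _
            · simp
        _ ≤ r ^ n := by
            rw [div_one]
            exact pow_le_pow_left₀ hy.1.le hy.2.le _
    · refine Summable.of_nonneg_of_le (fun n => div_nonneg (pow_nonneg hx.1.le _) (by positivity))
        (fun n => ?_) summable_one_div_succ_sq
      gcongr
      exact pow_le_one₀ hx.1.le hx.2.le
  convert key using 1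
  have h := Real.hasSum_pow_div_log_of_abs_lt_one (x := x) (by rw [abs_of_pos hx.1]; exact hx.2)
  have h2 := h.mul_left x⁻¹
  have : ∀ n : ℕ, x⁻¹ * (x ^ (n + 1) / ((n : ℝ) + 1)) = x ^ n / ((n : ℝ) + 1) := by
    intro n
    have := hx.1.ne'
    rw [pow_succ]; field_simp
  simp only [this] at h2
  rw [h2.tsum_eq]
  ring

/-- Controls the boundary terms at `0` of antiderivatives: `log (1 + c x)` is of order `x`, and `x
log x` tends to `0`. -/
theorem tendsto_log_mul_log_one_add (c : ℝ) :
    Tendsto (fun x : ℝ => Real.log x * Real.log (1 + c * x)) (𝓝[>] 0) (𝓝 0) := by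
  have h1 : Tendsto (fun x : ℝ => Real.log x * x) (𝓝[>] 0) (𝓝 0) := by
    simpa using tendsto_log_mul_rpow_nhdsGT_zero (r := 1) one_pos
  have h2 : Tendsto (fun x : ℝ => x⁻¹ * Real.log (1 + c * x)) (𝓝[>] 0) (𝓝 c) := by
    have hd : HasDerivAt (fun x : ℝ => Real.log (1 + c * x)) c 0 := by
      have := (((hasDerivAt_id (0 : ℝ)).const_mul c).const_add 1).log (by simp)
      simpa using this
    have := hd.tendsto_slope_zero_right
    simpa using this
  have := h1.mul h2
  simp only [zero_mul] at this
  refine this.congr' ?_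
  filter_upwards [self_mem_nhdsWithin] with x hx
  have : x ≠ 0 := (mem_Ioi.1 hx).ne'
  field_simp

/-- Euler's reflection formula. -/
theorem dilog_add_dilog_one_sub {x : ℝ} (hx : x ∈ Ioo (0 : ℝ) 1) :
    dilog x + dilog (1 - x) = Real.pi ^ 2 / 6 - Real.log x * Real.log (1 - x) := by
  set F : ℝ → ℝ := fun y => dilog y + dilog (1 - y) + Real.log y * Real.log (1 - y) with hF
  have hd : ∀ y ∈ Ioo (0 : ℝ) 1, HasDerivAt F 0 y := by
    intro y hy
    have hy' : 1 - y ∈ Ioo (0 : ℝ) 1 := ⟨by linarith [hy.2], by linarith [hy.1]⟩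
    have i : HasDerivAt (fun y : ℝ => 1 - y) (-1) y := by
      simpa using (hasDerivAt_id y).const_sub 1
    have h1 := hasDerivAt_dilog hy
    have h2 := (hasDerivAt_dilog hy').comp y i
    have h3 := (Real.hasDerivAt_log hy.1.ne').mul (i.log hy'.1.ne')
    refine ((h1.add h2).add h3).congr_deriv ?_
    have := hy.1.ne'
    have := hy'.1.ne'
    rw [sub_sub_cancel]
    field_simp
    ring
  have hlim : Tendsto F (𝓝[>] 0) (𝓝 (Real.pi ^ 2 / 6)) := by
    have hc0 : Tendsto dilog (𝓝[>] 0) (𝓝 (dilog 0)) := by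
      have := continuousOn_dilog 0 (by simp)
      refine this.mono_left ?_
      rw [← nhdsWithin_Ioo_eq_nhdsGT one_pos]
      exact nhdsWithin_mono _ Ioo_subset_Icc_self
    have hc1 : Tendsto (fun y => dilog (1 - y)) (𝓝[>] 0) (𝓝 (dilog 1)) := by
      have := continuousOn_dilog 1 (by simp)
      refine this.tendsto.comp (tendsto_nhdsWithin_iff.2 ⟨?_, ?_⟩)
      · have : Tendsto (fun y : ℝ => 1 - y) (𝓝 0) (𝓝 (1 - 0)) := tendsto_const_nhds.sub tendsto_id
        rw [sub_zero] at this
        exact this.mono_left nhdsWithin_le_nhds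
      · filter_upwards [Ioo_mem_nhdsGT (one_pos : (0 : ℝ) < 1)] with y hy
        exact ⟨by linarith [hy.2], by linarith [hy.1]⟩
    have := (hc0.add hc1).add (tendsto_log_mul_log_one_add (-1))
    simpa [dilog_zero, dilog_one, neg_one_mul, ← sub_eq_add_neg] using this
  have hconst : ∀ y ∈ Ioo (0 : ℝ) 1, F y = F x := by
    intro y hy
    refine (convex_Ioo (0 : ℝ) 1).is_const_of_fderivWithin_eq_zero (𝕜 := ℝ) ?_ ?_ hy hx
    · intro z hz
      exact (hd z hz).differentiableAt.differentiableWithinAt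
    · intro z hz
      rw [fderivWithin_of_isOpen isOpen_Ioo hz]
      ext
      simp [(hd z hz).deriv]
  have : Tendsto F (𝓝[>] 0) (𝓝 (F x)) := by
    refine tendsto_const_nhds.congr' ?_
    filter_upwards [Ioo_mem_nhdsGT (one_pos : (0 : ℝ) < 1)] with y hy
    exact (hconst y hy).symm
  have := tendsto_nhds_unique this hlim
  simp only [hF] at this
  linarith

theorem tendsto_dilog_comp_nhdsGT_zero {f : ℝ → ℝ} (hf : ContinuousAt f 0) (hf0 : f 0 = 0)
    (hpos : ∀ u ∈ Ioo (0 : ℝ) 1, f u ∈ Icc (0 : ℝ) 1) :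
    Tendsto (fun u => dilog (f u)) (𝓝[>] 0) (𝓝 0) := by
  have h := continuousOn_dilog 0 (by simp)
  rw [ContinuousWithinAt, dilog_zero] at h
  refine h.comp (tendsto_nhdsWithin_iff.2 ⟨?_, ?_⟩)
  · have : Tendsto f (𝓝 0) (𝓝 0) := by simpa [hf0] using hf.tendsto
    exact this.mono_left nhdsWithin_le_nhds
  · filter_upwards [Ioo_mem_nhdsGT (one_pos : (0 : ℝ) < 1)] with y hy using hpos y hy

/-- The density `1 / (u + g) + 1 / (G² - u)` of the folded odd continued fraction map,
with `g = (√5 - 1) / 2` and `G² = g + 2`. -/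
noncomputable def oddDensity (g u : ℝ) : ℝ := 1 / (u + g) + 1 / (g + 2 - u)

theorem continuousOn_oddDensity {g : ℝ} (hg : 0 < g) : ContinuousOn (oddDensity g) (Icc 0 1) := by
  unfold oddDensity
  refine (continuousOn_const.div (by fun_prop) fun u hu => ?_).add
    (continuousOn_const.div (by fun_prop) fun u hu => ?_)
  · linarith [hu.1]
  · linarith [hu.2]

theorem intervalIntegrable_log_mul_oddDensity {g : ℝ} (hg : 0 < g) :
    IntervalIntegrable (fun u => Real.log u * oddDensity g u) volume 0 1 := by
  refine intervalIntegral.intervalIntegrable_log'.mul_continuousOn ?_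
  rw [uIcc_of_le zero_le_one]
  exact continuousOn_oddDensity hg

/-- The equation of `g` makes the two dilogarithm arguments at `u = 1` equal to `g` and `1 - g`, so
Euler's reflection formula evaluates their sum; the squares of `log g` then cancel. -/
theorem integral_log_mul_oddDensity {g : ℝ} (hg : 0 < g) (hg2 : g ^ 2 + g = 1) :
    ∫ u in (0 : ℝ)..1, Real.log u * oddDensity g u = -(Real.pi ^ 2 / 6) := by
  have hg1 : g < 1 := by nlinarith
  -- The natural antiderivative contains `Li₂(-u/g)`. Landen's identity replaces it by
  -- `-Li₂(u/(u+g)) - log²(1+u/g)/2`, keeping all arguments in `[0,1]`.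
  set F : ℝ → ℝ := fun u => Real.log u * Real.log (1 + g⁻¹ * u) - dilog (u / (u + g))
    - Real.log (1 + g⁻¹ * u) ^ 2 / 2 - Real.log u * Real.log (1 + -(g + 2)⁻¹ * u)
    - dilog (u / (g + 2)) with hF
  have hd : ∀ u : ℝ, 0 < u → u ≤ 1 → HasDerivAt F (Real.log u * oddDensity g u) u := by
    intro u hu hu1
    have p1 : 0 < 1 + g⁻¹ * u := by positivity
    have p2 : 0 < 1 + -(g + 2)⁻¹ * u := by
      have : (g + 2)⁻¹ * u < 1 := by
        rw [inv_mul_lt_iff₀ (by linarith)]; linarith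
      linarith
    have q1 : u / (u + g) ∈ Ioo (0 : ℝ) 1 :=
      ⟨by positivity, by rw [div_lt_one (by linarith)]; linarith⟩
    have q2 : u / (g + 2) ∈ Ioo (0 : ℝ) 1 :=
      ⟨by positivity, by rw [div_lt_one (by linarith)]; linarith⟩
    have l := Real.hasDerivAt_log hu.ne'
    have l1 := (((hasDerivAt_id u).const_mul g⁻¹).const_add 1).log p1.ne'
    have l2 := (((hasDerivAt_id u).const_mul (-(g + 2)⁻¹)).const_add 1).log p2.ne'
    have d1 := (hasDerivAt_dilog q1).comp u
      ((hasDerivAt_id u).div ((hasDerivAt_id u).add_const g) (by simp only [id]; linarith))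
    have d2 := (hasDerivAt_dilog q2).comp u ((hasDerivAt_id u).div_const (g + 2))
    have := ((((l.mul l1).sub d1).sub ((l1.pow 2).div_const 2)).sub (l.mul l2)).sub d2
    refine this.congr_deriv ?_
    have e1 : Real.log (1 - u / (u + g)) = -Real.log (1 + g⁻¹ * u) := by
      rw [← Real.log_inv]
      congr 1
      field_simp
      ring
    have e2 : (1 : ℝ) - u / (g + 2) = 1 + -(g + 2)⁻¹ * u := by
      field_simp
      ring
    simp only [id, oddDensity, e1, e2]
    have e3 : 1 + -(g + 2)⁻¹ * u = (g + 2 - u) / (g + 2) := by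
      field_simp
      ring
    have n1 : g + 2 - u ≠ 0 := by linarith
    generalize Real.log (1 + g⁻¹ * u) = A
    generalize Real.log (1 + -(g + 2)⁻¹ * u) = B
    rw [e3]
    field_simp
    ring
  have h0 : Tendsto F (𝓝[>] 0) (𝓝 0) := by
    have t1 := tendsto_log_mul_log_one_add g⁻¹
    have t2 := tendsto_log_mul_log_one_add (-(g + 2)⁻¹)
    have t3 : Tendsto (fun u => dilog (u / (u + g))) (𝓝[>] 0) (𝓝 0) := by
      refine tendsto_dilog_comp_nhdsGT_zero ?_ (by simp) ?_
      · exact continuousAt_id.div (by fun_prop) (by simpa using hg.ne')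
      · intro u hu
        have := hu.1
        exact ⟨by positivity, by rw [div_le_one (by linarith)]; linarith⟩
    have t4 : Tendsto (fun u => dilog (u / (g + 2))) (𝓝[>] 0) (𝓝 0) := by
      refine tendsto_dilog_comp_nhdsGT_zero (by fun_prop) (by simp) ?_
      intro u hu
      have := hu.1
      exact ⟨by positivity, by rw [div_le_one (by linarith)]; linarith [hu.2]⟩
    have t5 : Tendsto (fun u => Real.log (1 + g⁻¹ * u) ^ 2 / 2) (𝓝[>] 0) (𝓝 0) := by
      have : ContinuousAt (fun u => Real.log (1 + g⁻¹ * u) ^ 2 / 2) 0 := by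
        refine ((ContinuousAt.log (by fun_prop) (by simp)).pow 2).div_const 2
      have := this.tendsto
      simp only [mul_zero, add_zero, Real.log_one] at this
      norm_num at this
      exact this.mono_left nhdsWithin_le_nhds
    have := (((t1.sub t3).sub t5).sub t2).sub t4
    simp only [sub_zero] at this
    exact this
  have h1 : Tendsto F (𝓝[<] 1) (𝓝 (F 1)) :=
    (hd 1 one_pos le_rfl).continuousAt.tendsto.mono_left nhdsWithin_le_nhds
  rw [intervalIntegral.integral_eq_sub_of_hasDerivAt_of_tendsto zero_lt_one
    (fun u hu => hd u hu.1 hu.2.le) (intervalIntegrable_log_mul_oddDensity hg) h0 h1]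
  have e1 : 1 / (1 + g) = g := by
    rw [div_eq_iff (by linarith)]; nlinarith
  have e2 : 1 / (g + 2) = 1 - g := by
    rw [div_eq_iff (by linarith)]; nlinarith
  have e3 : Real.log (1 + g⁻¹) = -(2 * Real.log g) := by
    have : 1 + g⁻¹ = (g ^ 2)⁻¹ := by
      field_simp; linarith
    rw [this, Real.log_inv, Real.log_pow]
    push_cast
    ring
  have e4 : Real.log (1 - g) = 2 * Real.log g := by
    have : 1 - g = g ^ 2 := by linarith
    rw [this, Real.log_pow]
    push_cast
    ring
  have r := dilog_add_dilog_one_sub ⟨hg, hg1⟩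
  rw [e4] at r
  simp only [hF, Real.log_one, e1, e2, mul_one, e3]
  linear_combination -r

end Dilogarithm

/-! ### Odd digits, the linear recursion and the denominators for the parameter `1`. -/

section OddDigits

open Set

variable {α x : ℝ}

theorem ocfMap_eq (hx : x ≠ 0) : ocfMap α x = 1 / |x| - ocfD α x := by
  simp [ocfMap, hx]

theorem ocfMap_abs (α x : ℝ) : ocfMap α |x| = ocfMap α x := by
  simp [ocfMap, ocfD]

theorem odd_ocfD (α x : ℝ) : Odd (ocfD α x) := ⟨_, rfl⟩

theorem ocfMap_mem (hx : x ≠ 0) : ocfMap α x ∈ Ico (α - 2) α := by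
  rw [ocfMap_eq hx, ocfD]
  have h1 := Int.floor_le (1 / (2 * |x|) + (1 - α) / 2)
  have h2 := Int.lt_floor_add_one (1 / (2 * |x|) + (1 - α) / 2)
  have e : 1 / (2 * |x|) = 1 / |x| / 2 := by
    rw [div_div, mul_comm]
  rw [e] at h1 h2 ⊢
  push_cast
  constructor <;> linarith

/-- The odd digit is the only odd integer `d` with `1 / |x| - d ∈ I_α`. -/
theorem ocfD_eq_of_mem {d : ℤ} (hx : x ≠ 0) (hd : Odd d)
    (h : 1 / |x| - d ∈ Ico (α - 2) α) : ocfD α x = d := by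
  obtain ⟨k, rfl⟩ := hd
  obtain ⟨l, hl⟩ := odd_ocfD α x
  have h' := ocfMap_mem (α := α) hx
  rw [ocfMap_eq hx, hl] at h'
  rw [hl]
  push_cast at h h'
  have h1 : (k : ℝ) < l + 1 := by linarith [h.1, h.2, h'.1, h'.2]
  have h2 : (l : ℝ) < k + 1 := by linarith [h.1, h.2, h'.1, h'.2]
  have h1' : k < l + 1 := by exact_mod_cast h1
  have h2' : l < k + 1 := by exact_mod_cast h2
  omega

theorem ocfMap_eq_of_mem {d : ℤ} (hx : x ≠ 0) (hd : Odd d)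
    (h : 1 / |x| - d ∈ Ico (α - 2) α) : ocfMap α x = 1 / |x| - d := by
  rw [ocfMap_eq hx, ocfD_eq_of_mem hx hd h]

theorem Irrational.abs_real (hx : Irrational x) : Irrational |x| := by
  rcases abs_choice x with h | h <;> rw [h]
  exacts [hx, hx.neg]

theorem Irrational.ocfMap (hx : Irrational x) : Irrational (ocfMap α x) := by
  rw [ocfMap_eq hx.ne_zero, one_div]
  exact (irrational_inv_iff.2 hx.abs_real).sub_intCast _

theorem Irrational.ocfMap_iterate (hx : Irrational x) (n : ℕ) :
    Irrational ((_root_.ocfMap α)^[n] x) := by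
  induction n with
  | zero => exact hx
  | succ n ih => rw [Function.iterate_succ_apply']; exact ih.ocfMap

theorem ocfE_of_pos (hx : 0 < x) : ocfE x = 1 := by simp [ocfE, hx]

theorem ocfE_of_neg (hx : x < 0) : ocfE x = -1 := by simp [ocfE, hx]

/-- One step of the expansion, acting on a point `x` together with two consecutive terms
`a = s_n`, `b = s_{n-1}` of a solution of `s_{n+1} = d_{n+1} s_n + e_{n+1} s_{n-1}`. -/
noncomputable def ocfStep (α : ℝ) (z : ℝ × ℝ × ℝ) : ℝ × ℝ × ℝ :=
  (ocfMap α z.1, ocfD α z.1 * z.2.1 + ocfE z.1 * z.2.2, z.2.1)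

/-- The recursion is linear. With the convention `q_{-1} = 0`, `p_{-1} = 1`, the start `(1, 0)`
produces `q_n` and the start `(x, -1)` produces `q_n x - p_n`. -/
theorem ocfStep_iterate_succ (α x a b : ℝ) (n : ℕ) :
    (ocfStep α)^[n + 1] (x, a, b) = ((ocfMap α)^[n + 1] x,
      a * ocfDen α x (n + 1) + b * ocfNum α x (n + 1), a * ocfDen α x n + b * ocfNum α x n) := by
  induction n with
  | zero => simp [ocfStep, ocfDen, ocfNum, ocfDigit, ocfSign, mul_comm]
  | succ n ih =>
    rw [Function.iterate_succ_apply', ih]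
    rw [Function.iterate_succ_apply' (ocfMap α) (n + 1)]
    simp only [ocfStep, ocfDen, ocfNum, ocfDigit, ocfSign, Prod.mk.injEq, true_and, and_true]
    push_cast
    ring

theorem ocfStep_iterate_fst (α : ℝ) (z : ℝ × ℝ × ℝ) (n : ℕ) :
    ((ocfStep α)^[n] z).1 = (ocfMap α)^[n] z.1 := by
  induction n with
  | zero => rfl
  | succ n ih => rw [Function.iterate_succ_apply', Function.iterate_succ_apply', ← ih]; rfl

theorem ocfStep_iterate_snd_fst (α x a b : ℝ) (n : ℕ) :
    ((ocfStep α)^[n] (x, a, b)).2.1 = a * ocfDen α x n + b * ocfNum α x n := by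
  cases n with
  | zero => simp [ocfDen, ocfNum]
  | succ n => rw [ocfStep_iterate_succ]

/-- Conditions satisfied by a point and two consecutive denominators of the expansion with
parameter `1`. -/
structure IsOddDenState (g : ℝ) (z : ℝ × ℝ × ℝ) : Prop where
  irr : Irrational z.1
  mem : z.1 ∈ Ico (-1 : ℝ) 1
  pos : 0 < z.2.1
  nonneg : 0 ≤ z.2.2
  le : g * z.2.2 ≤ z.2.1
  le_of_neg : z.1 < 0 → z.2.2 ≤ (1 - g) * z.2.1

theorem one_lt_one_div_abs (hx : Irrational x) (h : x ∈ Ico (-1 : ℝ) 1) : 1 < 1 / |x| := by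
  rw [lt_div_iff₀ (abs_pos.2 hx.ne_zero), one_mul]
  rw [abs_lt]
  refine ⟨lt_of_le_of_ne h.1 ?_, h.2⟩
  intro e
  exact hx.ne_int (-1) (by rw [← e]; simp)

theorem one_le_ocfD_one (hx : Irrational x) (h : x ∈ Ico (-1 : ℝ) 1) : (1 : ℝ) ≤ ocfD 1 x := by
  have h1 := one_lt_one_div_abs hx h
  have h2 := (ocfMap_mem (α := 1) hx.ne_zero).2
  rw [ocfMap_eq hx.ne_zero] at h2
  have : (0 : ℝ) < ocfD 1 x := by linarith
  have : 0 < ocfD 1 x := by exact_mod_cast this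
  exact_mod_cast (by omega : 1 ≤ ocfD 1 x)

/-- Since `1/|x| > 1`, a negative image excludes the digit `1`. This is what keeps denominators
growing when a minus sign follows. -/
theorem three_le_ocfD_one (hx : Irrational x) (h : x ∈ Ico (-1 : ℝ) 1) (h0 : ocfMap 1 x < 0) :
    (3 : ℝ) ≤ ocfD 1 x := by
  have h1 := one_lt_one_div_abs hx h
  rw [ocfMap_eq hx.ne_zero] at h0
  have : (1 : ℝ) < ocfD 1 x := by linarith
  have : 1 < ocfD 1 x := by exact_mod_cast this
  obtain ⟨k, hk⟩ := odd_ocfD 1 x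
  exact_mod_cast (by omega : 3 ≤ ocfD 1 x)

theorem ocfMap_one_mem (hx : Irrational x) : ocfMap 1 x ∈ Ico (-1 : ℝ) 1 := by
  have := ocfMap_mem (α := 1) hx.ne_zero
  norm_num at this ⊢
  exact this

theorem IsOddDenState.step {g : ℝ} (hg : 0 < g) (hg2 : g ^ 2 + g = 1) {z : ℝ × ℝ × ℝ}
    (h : IsOddDenState g z) : IsOddDenState g (ocfStep 1 z) := by
  obtain ⟨t, u, v⟩ := z
  obtain ⟨irr, mem, pos, nonneg, le, le_neg⟩ := h
  simp only at irr mem pos nonneg le le_neg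
  have hg3 : g < 2 / 3 := by nlinarith
  have d1 := one_le_ocfD_one irr mem
  rcases lt_or_gt_of_ne irr.ne_zero with ht | ht
  · have hv := le_neg ht
    have key : (ocfD 1 t - 1 + g) * u ≤ ocfD 1 t * u - v := by nlinarith
    have hgu : g * u ≤ ocfD 1 t * u - v := by nlinarith
    refine ⟨irr.ocfMap, ocfMap_one_mem irr, ?_, pos.le, ?_, fun h => ?_⟩ <;>
      simp only [ocfStep, ocfE_of_neg ht] <;> push_cast
    · nlinarith
    · linarith
    · have d3 := three_le_ocfD_one irr mem h
      have : (2 + g) * u ≤ ocfD 1 t * u - v := by nlinarith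
      have h1 : (1 - g) * ((2 + g) * u) ≤ (1 - g) * (ocfD 1 t * u - v) :=
        mul_le_mul_of_nonneg_left this (by linarith)
      -- The invariant reproduces itself because `(1 - g)(2 + g) = 1`; this is why the constant in
      -- `le_of_neg` is `1 - g`.
      have h2 : (1 - g) * ((2 + g) * u) = u := by linear_combination -u * hg2
      linarith
  · have hu : u ≤ ocfD 1 t * u := by nlinarith
    refine ⟨irr.ocfMap, ocfMap_one_mem irr, ?_, pos.le, ?_, fun h => ?_⟩ <;>
      simp only [ocfStep, ocfE_of_pos ht] <;> push_cast
    · linarith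
    · nlinarith
    · have d3 := three_le_ocfD_one irr mem h
      have : 3 * u ≤ ocfD 1 t * u + 1 * v := by nlinarith
      nlinarith

theorem isOddDenState_init {g : ℝ} (hg : g < 1) (hx : Irrational x) (h : x ∈ Ico (-1 : ℝ) 1) :
    IsOddDenState g (x, 1, 0) :=
  ⟨hx, h, one_pos, le_rfl, by simp, fun _ => by simp only; linarith⟩

theorem IsOddDenState.iterate {g : ℝ} (hg : 0 < g) (hg2 : g ^ 2 + g = 1) {z : ℝ × ℝ × ℝ}
    (h : IsOddDenState g z) (n : ℕ) : IsOddDenState g ((ocfStep 1)^[n] z) := by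
  induction n with
  | zero => exact h
  | succ n ih => rw [Function.iterate_succ_apply']; exact ih.step hg hg2

/-- The denominators grow by the factor `1 + g` in two steps. -/
theorem IsOddDenState.le_step_step {g : ℝ} (hg : 0 < g) (hg2 : g ^ 2 + g = 1) {z : ℝ × ℝ × ℝ}
    (h : IsOddDenState g z) : (1 + g) * z.2.1 ≤ (ocfStep 1 (ocfStep 1 z)).2.1 := by
  have h1 := h.step hg hg2
  obtain ⟨irr, mem, pos, nonneg, le, le_neg⟩ := h1
  have d1 := one_le_ocfD_one irr mem
  have e : (ocfStep 1 z).2.2 = z.2.1 := rfl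
  rw [e] at nonneg le le_neg
  rw [ocfStep, e]
  simp only
  rcases lt_or_gt_of_ne irr.ne_zero with ht | ht
  · have hv := le_neg ht
    rw [ocfE_of_neg ht]
    push_cast
    have h1 : (2 + g) * z.2.1 ≤ (2 + g) * ((1 - g) * (ocfStep 1 z).2.1) :=
      mul_le_mul_of_nonneg_left hv (by linarith)
    have h2 : (2 + g) * ((1 - g) * (ocfStep 1 z).2.1) = (ocfStep 1 z).2.1 := by
      linear_combination -(ocfStep 1 z).2.1 * hg2
    have h3 : (ocfStep 1 z).2.1 ≤ ocfD 1 (ocfStep 1 z).1 * (ocfStep 1 z).2.1 := by nlinarith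
    linarith
  · rw [ocfE_of_pos ht]
    push_cast
    nlinarith

theorem IsOddDenState.pow_le_iterate {g : ℝ} (hg : 0 < g) (hg2 : g ^ 2 + g = 1) {z : ℝ × ℝ × ℝ}
    (h : IsOddDenState g z) (n : ℕ) :
    (1 + g) ^ n * z.2.1 ≤ ((ocfStep 1)^[2 * n] z).2.1 := by
  induction n with
  | zero => simp
  | succ n ih =>
    have := (h.iterate hg hg2 (2 * n)).le_step_step hg hg2
    rw [← Function.iterate_succ_apply' (ocfStep 1), ← Function.iterate_succ_apply' (ocfStep 1)]
      at this
    refine le_trans ?_ this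
    rw [pow_succ, mul_comm ((1 + g) ^ n), mul_assoc]
    exact mul_le_mul_of_nonneg_left ih (by linarith)

/-- The relation `s_n = -x_n s_{n-1}` satisfied by `s_n = q_n x - p_n` is preserved. -/
theorem ocfStep_neg_mul {z : ℝ × ℝ × ℝ} (h0 : z.1 ≠ 0) (h : z.2.1 = -z.1 * z.2.2) :
    (ocfStep α z).2.1 = -(ocfStep α z).1 * (ocfStep α z).2.2 := by
  obtain ⟨t, u, v⟩ := z
  simp only at h0 h
  simp only [ocfStep, ocfMap_eq h0]
  rcases lt_or_gt_of_ne h0 with ht | ht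
  · rw [ocfE_of_neg ht, abs_of_neg ht, h]
    push_cast
    field_simp
    ring
  · rw [ocfE_of_pos ht, abs_of_pos ht, h]
    push_cast
    field_simp
    ring

theorem ocfStep_iterate_neg_mul (hx : Irrational x) (n : ℕ) :
    ((ocfStep α)^[n] (x, x, -1)).2.1 =
      -((ocfStep α)^[n] (x, x, -1)).1 * ((ocfStep α)^[n] (x, x, -1)).2.2 := by
  induction n with
  | zero => simp
  | succ n ih =>
    rw [Function.iterate_succ_apply']
    refine ocfStep_neg_mul ?_ ih
    rw [ocfStep_iterate_fst]
    exact (hx.ocfMap_iterate n).ne_zero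

/-- Passing from `n` to `n + 1` multiplies the first factor by `|x_n|`, while `|x_n| (q_{n+1} +
x_{n+1} q_n) = q_n + x_n q_{n-1}`, so the product is conserved. -/
theorem ocfStep_iterate_det (hx : Irrational x) (n : ℕ) :
    |((ocfStep α)^[n] (x, x, -1)).2.2| *
      (((ocfStep α)^[n] (x, 1, 0)).2.1 +
        (ocfMap α)^[n] x * ((ocfStep α)^[n] (x, 1, 0)).2.2) = 1 := by
  induction n with
  | zero => simp
  | succ n ih =>
    have h1 := ocfStep_iterate_neg_mul (α := α) hx n
    have f1 := ocfStep_iterate_fst α (x, x, -1) n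
    have f2 := ocfStep_iterate_fst α (x, 1, 0) n
    have h0 := (hx.ocfMap_iterate (α := α) n).ne_zero
    refine Eq.trans ?_ ih
    simp only [Function.iterate_succ_apply' _ n, ocfStep]
    simp only at f1 f2
    rw [f2, h1, f1]
    generalize (ocfMap α)^[n] x = t at h0 ⊢
    rw [ocfMap_eq h0, abs_mul, abs_neg]
    generalize ((ocfStep α)^[n] (x, 1, 0)).2.1 = u
    generalize ((ocfStep α)^[n] (x, 1, 0)).2.2 = v
    rcases lt_or_gt_of_ne h0 with ht | ht
    · rw [ocfE_of_neg ht, abs_of_neg ht]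
      push_cast
      field_simp
      ring
    · rw [ocfE_of_pos ht, abs_of_pos ht]
      push_cast
      field_simp
      ring

/-- The folded odd continued fraction map `u ↦ |φ_1(u)|`. -/
noncomputable def oddFold (u : ℝ) : ℝ := |ocfMap 1 u|

theorem oddFold_iterate_abs (x : ℝ) (n : ℕ) : oddFold^[n] |x| = |(ocfMap 1)^[n] x| := by
  induction n with
  | zero => rfl
  | succ n ih =>
    rw [Function.iterate_succ_apply', Function.iterate_succ_apply', ih, oddFold, ocfMap_abs]

/-- The quantity `log |q_{n-1} x - p_{n-1}|` is a Birkhoff sum of `log`. -/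
theorem log_abs_eq_birkhoffSum (hx : Irrational x) (n : ℕ) :
    Real.log |((ocfStep 1)^[n] (x, x, -1)).2.2| = birkhoffSum oddFold Real.log n |x| := by
  induction n with
  | zero => simp
  | succ n ih =>
    have h1 := ocfStep_iterate_neg_mul (α := 1) hx n
    have f1 := ocfStep_iterate_fst 1 (x, x, -1) n
    have h0 := (hx.ocfMap_iterate (α := 1) n).ne_zero
    have h2 : ((ocfStep 1)^[n] (x, x, -1)).2.2 ≠ 0 := by
      intro h
      have := ocfStep_iterate_det (α := 1) hx n
      simp [h] at this
    rw [birkhoffSum_succ, ← ih, Function.iterate_succ_apply', ocfStep]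
    simp only
    rw [h1, f1, abs_mul, abs_neg, Real.log_mul (by simpa using h0) (by simpa using h2),
      oddFold_iterate_abs, add_comm]

end OddDigits

/-! ### Inverse branches and the invariant measure of the folded map. -/

section OddFoldInvariance

open Set MeasureTheory Filter Topology

/-- The irrational points of `(0, 1)`. -/
def oddSet : Set ℝ := Ioo 0 1 ∩ {x | Irrational x}

theorem ae_irrational : ∀ᵐ x : ℝ, Irrational x :=
  (countable_range ((↑) : ℚ → ℝ)).ae_notMem volume

theorem measurableSet_irrational : MeasurableSet {x : ℝ | Irrational x} :=
  (countable_range ((↑) : ℚ → ℝ)).measurableSet.compl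

theorem measurableSet_oddSet : MeasurableSet oddSet :=
  measurableSet_Ioo.inter measurableSet_irrational

theorem oddSet_ae_eq : oddSet =ᵐ[volume] Ioo (0 : ℝ) 1 := by
  filter_upwards [ae_irrational] with x hx
  exact propext ⟨fun h => h.1, fun h => ⟨h, hx⟩⟩

theorem measurable_ocfMap (α : ℝ) : Measurable (ocfMap α) := by
  have h : Measurable fun x : ℝ => ⌊1 / (2 * |x|) + (1 - α) / 2⌋ :=
    Int.measurable_floor.comp (by fun_prop)
  have h2 : Measurable fun x : ℝ => ((ocfD α x : ℤ) : ℝ) := by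
    simp only [ocfD]
    push_cast
    exact ((measurable_from_top.comp h).const_mul 2).add_const 1
  unfold ocfMap
  refine Measurable.ite (measurableSet_singleton 0) measurable_const ?_
  exact Measurable.sub (by fun_prop) h2

theorem measurable_oddFold : Measurable oddFold := (measurable_ocfMap 1).abs

theorem mem_oddSet_abs {t : ℝ} (hx : Irrational t) (h : t ∈ Ico (-1 : ℝ) 1) : |t| ∈ oddSet := by
  refine ⟨⟨abs_pos.2 hx.ne_zero, ?_⟩, hx.abs_real⟩
  have := one_lt_one_div_abs hx h
  rwa [lt_div_iff₀ (abs_pos.2 hx.ne_zero), one_mul] at this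

theorem irrational_sign_mul {s w : ℝ} (hs : s = 1 ∨ s = -1) (hw : Irrational w) :
    Irrational (s * w) := by
  rcases hs with rfl | rfl
  · simpa using hw
  · simpa using hw.neg

/-- The inverse branches of the folded map. -/
theorem branch_mem_oddSet {m : ℤ} {s w : ℝ} (hm : Odd m) (hs : s = 1 ∨ s = -1)
    (hw : w ∈ oddSet) (h1 : 1 < m + s * w) :
    1 / (m + s * w) ∈ oddSet ∧ ocfMap 1 (1 / (m + s * w)) = s * w := by
  have hp : (0 : ℝ) < m + s * w := by linarith
  have hirr : Irrational (1 / (m + s * w)) := by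
    rw [one_div]
    exact irrational_inv_iff.2 ((irrational_sign_mul hs hw.2).intCast_add m)
  refine ⟨⟨⟨by positivity, by rw [div_lt_one hp]; exact h1⟩, hirr⟩, ?_⟩
  rw [ocfMap_eq_of_mem hirr.ne_zero hm] <;> rw [abs_of_pos (by positivity), one_div_one_div]
  · ring
  · have := hw.1.1
    have := hw.1.2
    rcases hs with rfl | rfl <;> constructor <;> linarith

theorem branch_oddFold {m : ℤ} {s w : ℝ} (hm : Odd m) (hs : s = 1 ∨ s = -1)
    (hw : w ∈ oddSet) (h1 : 1 < m + s * w) : oddFold (1 / (m + s * w)) = w := by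
  rw [oddFold, (branch_mem_oddSet hm hs hw h1).2, abs_mul, abs_of_pos hw.1.1]
  rcases hs with rfl | rfl <;> simp

/-- The branches `v ↦ 1 / (a + 2 j + s v)`. -/
noncomputable def oddBranch (a s : ℝ) (j : ℕ) (v : ℝ) : ℝ := 1 / (a + 2 * j + s * v)

theorem oddFold_preimage_inter (A : Set ℝ) :
    oddFold ⁻¹' A ∩ oddSet =
      (⋃ j, oddBranch 1 1 j '' (A ∩ oddSet)) ∪ ⋃ j, oddBranch 3 (-1) j '' (A ∩ oddSet) := by
  ext u
  simp only [mem_inter_iff, mem_preimage, mem_union, mem_iUnion, mem_image]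
  constructor
  · rintro ⟨hA, hu⟩
    have hmem : u ∈ Ico (-1 : ℝ) 1 := ⟨by linarith [hu.1.1], hu.1.2⟩
    have ht := ocfMap_one_mem hu.2
    have hti : Irrational (ocfMap 1 u) := hu.2.ocfMap
    have hd1 := one_le_ocfD_one hu.2 hmem
    have hT := mem_oddSet_abs hti ht
    have he := ocfMap_eq (α := 1) hu.2.ne_zero
    rw [abs_of_pos hu.1.1] at he
    obtain ⟨k, hk⟩ := odd_ocfD 1 u
    have hu' : u = 1 / (ocfD 1 u + ocfMap 1 u) := by
      rw [he, add_sub_cancel, one_div_one_div]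
    rw [oddFold] at hA
    rcases lt_or_gt_of_ne hti.ne_zero with hneg | hpos
    · right
      have hd3 := three_le_ocfD_one hu.2 hmem hneg
      have : 3 ≤ ocfD 1 u := by exact_mod_cast hd3
      obtain ⟨j, hj⟩ := Int.eq_ofNat_of_zero_le (by omega : 0 ≤ k - 1)
      refine ⟨j, |ocfMap 1 u|, ⟨hA, hT⟩, ?_⟩
      rw [oddBranch, abs_of_neg hneg]
      refine Eq.trans ?_ hu'.symm
      congr 1
      have : k = j + 1 := by omega
      rw [hk, this]
      push_cast
      ring
    · left
      have : 1 ≤ ocfD 1 u := by exact_mod_cast hd1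
      obtain ⟨j, hj⟩ := Int.eq_ofNat_of_zero_le (by omega : 0 ≤ k)
      refine ⟨j, |ocfMap 1 u|, ⟨hA, hT⟩, ?_⟩
      rw [oddBranch, abs_of_pos hpos]
      refine Eq.trans ?_ hu'.symm
      congr 1
      rw [hk, hj]
      push_cast
      ring
  · rintro (⟨j, w, ⟨hwA, hw⟩, rfl⟩ | ⟨j, w, ⟨hwA, hw⟩, rfl⟩)
    · have e : oddBranch 1 1 j w = 1 / (((2 * j + 1 : ℤ) : ℝ) + 1 * w) := by
        rw [oddBranch]; push_cast; ring
      have hm : Odd (2 * (j : ℤ) + 1) := ⟨j, rfl⟩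
      have h1 : (1 : ℝ) < ((2 * j + 1 : ℤ) : ℝ) + 1 * w := by
        push_cast
        have : (0 : ℝ) ≤ j := j.cast_nonneg
        linarith [hw.1.1]
      rw [e, branch_oddFold hm (Or.inl rfl) hw h1]
      exact ⟨hwA, (branch_mem_oddSet hm (Or.inl rfl) hw h1).1⟩
    · have e : oddBranch 3 (-1) j w = 1 / (((2 * (j + 1) + 1 : ℤ) : ℝ) + (-1) * w) := by
        rw [oddBranch]; push_cast; ring
      have hm : Odd (2 * ((j : ℤ) + 1) + 1) := ⟨j + 1, rfl⟩
      have h1 : (1 : ℝ) < ((2 * (j + 1) + 1 : ℤ) : ℝ) + (-1) * w := by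
        push_cast
        have : (0 : ℝ) ≤ j := j.cast_nonneg
        linarith [hw.1.2]
      rw [e, branch_oddFold hm (Or.inr rfl) hw h1]
      exact ⟨hwA, (branch_mem_oddSet hm (Or.inr rfl) hw h1).1⟩

theorem branch_index_eq {i j : ℕ} {d : ℝ} (hd : d ∈ Ioo (-1 : ℝ) 1)
    (h : 2 * (i : ℝ) = 2 * j + d) : i = j := by
  have h1 : (i : ℝ) < j + 1 := by linarith [hd.2]
  have h2 : (j : ℝ) < i + 1 := by linarith [hd.1]
  have h1' : i < j + 1 := by exact_mod_cast h1
  have h2' : j < i + 1 := by exact_mod_cast h2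
  omega

theorem hasSum_telescope {h : ℕ → ℝ} (hanti : ∀ j, h (j + 1) ≤ h j)
    (hlim : Tendsto h atTop (𝓝 0)) : HasSum (fun j => h j - h (j + 1)) (h 0) := by
  rw [hasSum_iff_tendsto_nat_of_nonneg (fun j => sub_nonneg.2 (hanti j))]
  simp only [Finset.sum_range_sub']
  simpa using hlim.const_sub (h 0)

/-- The transfer operator of a family of branches, applied to the density, telescopes. -/
theorem tsum_branch_weight {g w : ℝ} (hg : 0 < g) (hg2 : g ^ 2 + g = 1) (hw : 1 ≤ w) :
    ∑' j : ℕ, ENNReal.ofReal (1 / (w + 2 * j) ^ 2) *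
      ENNReal.ofReal (oddDensity g (1 / (w + 2 * j))) = ENNReal.ofReal (1 / (w - (1 - g))) := by
  -- With `W = w + 2j`, partial fractions and the equation of `g` turn the `j`-th weight into
  -- `1/(W-(1-g)) - 1/(W+2-(1-g))`.
  set h : ℕ → ℝ := fun j => 1 / (w + 2 * j - (1 - g)) with hh
  have hpos : ∀ j : ℕ, 0 < w + 2 * j - (1 - g) := fun j => by
    have : (0 : ℝ) ≤ j := j.cast_nonneg
    linarith
  have hanti : ∀ j, h (j + 1) ≤ h j := fun j => by
    refine one_div_le_one_div_of_le (hpos j) ?_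
    push_cast
    linarith
  have hlim : Tendsto h atTop (𝓝 0) := by
    have : Tendsto (fun j : ℕ => w + 2 * (j : ℝ) - (1 - g)) atTop atTop := by
      refine tendsto_atTop_add_const_right _ _ (tendsto_atTop_add_const_left _ _ ?_)
      exact tendsto_natCast_atTop_atTop.const_mul_atTop two_pos
    simp only [hh, one_div]
    exact this.inv_tendsto_atTop
  have hs := hasSum_telescope hanti hlim
  have h0 : h 0 = 1 / (w - (1 - g)) := by simp [hh]
  rw [← h0, ← hs.tsum_eq, ENNReal.ofReal_tsum_of_nonneg (fun j => sub_nonneg.2 (hanti j))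
    hs.summable]
  congr 1
  ext j
  rw [← ENNReal.ofReal_mul (by positivity)]
  congr 1
  have p1 := hpos j
  have p2 := hpos (j + 1)
  have p0 : 0 < w + 2 * j := by linarith
  simp only [hh, oddDensity]
  push_cast at p2 ⊢
  generalize hW : w + 2 * (j : ℝ) = W at *
  have e : w + 2 * ((j : ℝ) + 1) = W + 2 := by rw [← hW]; ring
  rw [e] at p2 ⊢
  have hg1 : g < 1 := by nlinarith
  have n1 : 0 < 1 + g * W := by positivity
  have n2 : 0 < (g + 2) * W - 1 := by
    have : (g + 2) * (W - (1 - g)) = (g + 2) * W - 1 := by linear_combination hg2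
    rw [← this]
    positivity
  have f1 : 1 / (1 / W + g) = W / (1 + g * W) := by field_simp
  have f2 : 1 / (g + 2 - 1 / W) = W / ((g + 2) * W - 1) := by
    rw [div_eq_div_iff _ n2.ne']
    · field_simp
    · have : g + 2 - 1 / W = ((g + 2) * W - 1) / W := by field_simp
      rw [this]
      positivity
  have f3 : 1 / (W - (1 - g)) = (g + 2) / ((g + 2) * W - 1) := by
    rw [div_eq_div_iff p1.ne' n2.ne']
    linear_combination -hg2
  have f4 : 1 / (W + 2 - (1 - g)) = g / (1 + g * W) := by
    rw [div_eq_div_iff p2.ne' n1.ne']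
    linear_combination -hg2
  rw [f1, f2, f3, f4]
  generalize hD : (g + 2) * W - 1 = D at n2
  field_simp
  linear_combination -(1 + g * W) * hD

/-- Change of variables on each of the disjoint branch images; the summed weights are then collapsed
by `tsum_branch_weight`. -/
theorem lintegral_iUnion_oddBranch {g a s : ℝ} (hg : 0 < g) (hg2 : g ^ 2 + g = 1)
    (hs : s = 1 ∨ s = -1) (has : ∀ v ∈ Ioo (0 : ℝ) 1, 1 ≤ a + s * v) {B : Set ℝ}
    (hB : MeasurableSet B) (hB1 : B ⊆ Ioo 0 1) :
    MeasurableSet (⋃ j, oddBranch a s j '' B) ∧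
    ∫⁻ u in ⋃ j, oddBranch a s j '' B, ENNReal.ofReal (oddDensity g u) =
      ∫⁻ v in B, ENNReal.ofReal (1 / (a + s * v - (1 - g))) := by
  have hpos : ∀ j : ℕ, ∀ v ∈ B, 0 < a + 2 * j + s * v := fun j v hv => by
    have := has v (hB1 hv)
    have : (0 : ℝ) ≤ j := j.cast_nonneg
    linarith
  have hs0 : s ≠ 0 := by rcases hs with rfl | rfl <;> norm_num
  have habs : |s| = 1 := by rcases hs with rfl | rfl <;> norm_num
  have hderiv : ∀ j : ℕ, ∀ v ∈ B,
      HasDerivWithinAt (oddBranch a s j) (-s / (a + 2 * j + s * v) ^ 2) B v := fun j v hv => by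
    have h1 : HasDerivAt (fun v : ℝ => a + 2 * j + s * v) s v := by
      simpa using ((hasDerivAt_id v).const_mul s).const_add (a + 2 * j)
    have h2 := h1.inv (hpos j v hv).ne'
    refine HasDerivAt.hasDerivWithinAt ?_
    have e : oddBranch a s j = (fun v : ℝ => a + 2 * j + s * v)⁻¹ := by
      ext v; simp [oddBranch]
    rw [e]
    exact h2
  have hinj : ∀ j : ℕ, InjOn (oddBranch a s j) B := fun j v hv w hw hvw => by
    simp only [oddBranch] at hvw
    rw [div_eq_div_iff (hpos j v hv).ne' (hpos j w hw).ne'] at hvw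
    have : s * v = s * w := by linarith
    exact mul_left_cancel₀ hs0 this
  have hmeas : ∀ j : ℕ, MeasurableSet (oddBranch a s j '' B) := fun j =>
    hB.image_of_continuousOn_injOn (fun v hv => (hderiv j v hv).continuousWithinAt) (hinj j)
  have hdisj : Pairwise (Function.onFun Disjoint fun j => oddBranch a s j '' B) := by
    intro i j hij
    rw [Function.onFun, Set.disjoint_left]
    rintro _ ⟨v, hv, rfl⟩ ⟨w, hw, hvw⟩
    simp only [oddBranch] at hvw
    rw [div_eq_div_iff (hpos j w hw).ne' (hpos i v hv).ne'] at hvw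
    have hv1 := hB1 hv
    have hw1 := hB1 hw
    refine hij (branch_index_eq (d := s * (w - v)) ?_ (by linarith))
    rcases hs with rfl | rfl <;> constructor <;> linarith [hv1.1, hv1.2, hw1.1, hw1.2]
  refine ⟨MeasurableSet.iUnion hmeas, ?_⟩
  rw [lintegral_iUnion hmeas hdisj]
  have : ∀ j : ℕ, ∫⁻ u in oddBranch a s j '' B, ENNReal.ofReal (oddDensity g u) =
      ∫⁻ v in B, ENNReal.ofReal (1 / (a + s * v + 2 * j) ^ 2) *
        ENNReal.ofReal (oddDensity g (1 / (a + s * v + 2 * j))) := fun j => by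
    rw [lintegral_image_eq_lintegral_abs_deriv_mul hB (hderiv j) (hinj j)]
    refine setLIntegral_congr_fun hB fun v _ => ?_
    have e : a + s * v + 2 * (j : ℝ) = a + 2 * j + s * v := by ring
    simp only [oddBranch, e, abs_div, abs_neg, habs, abs_pow, sq_abs]
  simp only [this]
  rw [← lintegral_tsum]
  · refine setLIntegral_congr_fun hB fun v hv => ?_
    exact tsum_branch_weight hg hg2 (has v (hB1 hv))
  · intro j
    refine Measurable.aemeasurable ?_
    unfold oddDensity
    fun_prop

/-- The invariant measure of the folded odd continued fraction map, not normalized. -/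
noncomputable def oddMeasure (g : ℝ) : Measure ℝ :=
  (volume.restrict oddSet).withDensity fun u => ENNReal.ofReal (oddDensity g u)

theorem oddMeasure_apply (g : ℝ) {A : Set ℝ} (hA : MeasurableSet A) :
    oddMeasure g A = ∫⁻ u in A ∩ oddSet, ENNReal.ofReal (oddDensity g u) := by
  rw [oddMeasure, withDensity_apply _ hA, Measure.restrict_restrict hA]

/-- Each family of branches returns one summand of the density: `1/(m + v)` with odd `m ≥ 1` gives
`1/(v + g)`, and `1/(m - v)` with odd `m ≥ 3` gives `1/(g + 2 - v)`. -/
theorem measurePreserving_oddFold {g : ℝ} (hg : 0 < g) (hg2 : g ^ 2 + g = 1) :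
    MeasurePreserving oddFold (oddMeasure g) (oddMeasure g) := by
  refine ⟨measurable_oddFold, Measure.ext fun A hA => ?_⟩
  rw [Measure.map_apply measurable_oddFold hA, oddMeasure_apply g (measurable_oddFold hA),
    oddMeasure_apply g hA, oddFold_preimage_inter]
  have hB := hA.inter measurableSet_oddSet
  have hB1 : A ∩ oddSet ⊆ Ioo 0 1 := fun x hx => hx.2.1
  obtain ⟨m1, e1⟩ := lintegral_iUnion_oddBranch (a := 1) (s := 1) hg hg2 (Or.inl rfl)
    (fun v hv => by linarith [hv.1]) hB hB1
  obtain ⟨m2, e2⟩ := lintegral_iUnion_oddBranch (a := 3) (s := -1) hg hg2 (Or.inr rfl)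
    (fun v hv => by linarith [hv.2]) hB hB1
  rw [lintegral_union m2, e1, e2, ← lintegral_add_left]
  · refine setLIntegral_congr_fun hB fun v hv => ?_
    have hv1 := hB1 hv
    have hg1 : g < 1 := by nlinarith
    rw [← ENNReal.ofReal_add]
    · rw [oddDensity]
      congr 3 <;> ring
    · exact one_div_nonneg.2 (by linarith [hv1.1])
    · exact one_div_nonneg.2 (by linarith [hv1.2])
  · fun_prop
  · rw [Set.disjoint_left]
    rintro u hu1 hu2
    simp only [mem_iUnion, mem_image] at hu1 hu2
    obtain ⟨i, v, hv, rfl⟩ := hu1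
    obtain ⟨j, w, hw, hvw⟩ := hu2
    have hv1 := hB1 hv
    have hw1 := hB1 hw
    have ci : (0 : ℝ) ≤ i := i.cast_nonneg
    have cj : (0 : ℝ) ≤ j := j.cast_nonneg
    simp only [oddBranch] at hvw
    rw [div_eq_div_iff (by linarith [hw1.2]) (by linarith [hv1.1])] at hvw
    have h : 2 * (i : ℝ) = 2 * j + (2 - (v + w)) := by linarith
    have h1 : (i : ℝ) < j + 1 := by linarith [hv1.1, hw1.1]
    have h2 : (j : ℝ) < i := by linarith [hv1.2, hw1.2]
    have h1' : i < j + 1 := by exact_mod_cast h1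
    have h2' : j < i := by exact_mod_cast h2
    omega

end OddFoldInvariance

/-! ### Bounded distortion and ergodicity of the folded map. -/

section OddFoldErgodicity

open Set MeasureTheory Filter Topology

/-- The distortion estimate: the denominator of the `n`-th inverse branch is comparable to `q_n`,
uniformly in `w`. With `w = |x_n|` it also makes `q_n + x_n q_{n-1}` comparable to `q_n`. -/
theorem mul_le_add_mul_of_state {g w : ℝ} (hg : 0 < g) (hg1 : g ≤ 1) {z : ℝ × ℝ × ℝ}
    (h : IsOddDenState g z) (hw : w ∈ Icc (0 : ℝ) 1) :
    g * z.2.1 ≤ z.2.1 + ocfE z.1 * z.2.2 * w ∧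
      z.2.1 + ocfE z.1 * z.2.2 * w ≤ (1 + g⁻¹) * z.2.1 := by
  obtain ⟨irr, mem, pos, nonneg, le, le_neg⟩ := h
  have hv : z.2.2 ≤ g⁻¹ * z.2.1 := by
    rw [inv_mul_eq_div, le_div_iff₀ hg]; linarith
  have h1 : 0 ≤ z.2.2 * w := mul_nonneg nonneg hw.1
  have h2 : z.2.2 * w ≤ z.2.2 := mul_le_of_le_one_right nonneg hw.2
  have h3 : 0 < g⁻¹ * z.2.1 := by positivity
  rcases lt_or_gt_of_ne irr.ne_zero with ht | ht
  · have := le_neg ht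
    rw [ocfE_of_neg ht]
    push_cast
    constructor <;> linarith
  · rw [ocfE_of_pos ht]
    push_cast
    refine ⟨?_, by linarith⟩
    nlinarith

theorem ocfE_eq_one_or {t : ℝ} (ht : t ≠ 0) : (ocfE t : ℝ) = 1 ∨ (ocfE t : ℝ) = -1 := by
  rcases lt_or_gt_of_ne ht with h | h
  · right; rw [ocfE_of_neg h]; simp
  · left; rw [ocfE_of_pos h]; simp

theorem ocfE_mul_abs {t : ℝ} (ht : t ≠ 0) : (ocfE t : ℝ) * |t| = t := by
  rcases lt_or_gt_of_ne ht with h | h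
  · rw [ocfE_of_neg h, abs_of_neg h]; simp
  · rw [ocfE_of_pos h, abs_of_pos h]; simp

theorem one_lt_ocfD_add {t w : ℝ} (ht : Irrational t) (hm : t ∈ Ico (-1 : ℝ) 1)
    (hw : w ∈ oddSet) : 1 < (ocfD 1 t : ℝ) + ocfE (ocfMap 1 t) * w := by
  have hti : Irrational (ocfMap 1 t) := ht.ocfMap
  rcases lt_or_gt_of_ne hti.ne_zero with h | h
  · have := three_le_ocfD_one ht hm h
    rw [ocfE_of_neg h]
    push_cast
    linarith [hw.1.2]
  · have := one_le_ocfD_one ht hm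
    rw [ocfE_of_pos h]
    push_cast
    linarith [hw.1.1]

/-- The inverse branch of the `n`-th iterate of the folded map through a given point. -/
theorem exists_inverse_branch {g x : ℝ} (hg : 0 < g) (hg2 : g ^ 2 + g = 1) (hx : Irrational x)
    (hm : x ∈ Ico (-1 : ℝ) 1) (n : ℕ) :
    ∃ M : ℝ → ℝ, M |(ocfMap 1)^[n] x| = |x| ∧
      (∀ w ∈ oddSet, M w ∈ oddSet ∧ oddFold^[n] (M w) = w) ∧
      ∀ w ∈ oddSet, ∀ w' ∈ oddSet, ∀ z, z = (ocfStep 1)^[n] (x, 1, 0) →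
        |M w - M w'| * ((z.2.1 + ocfE z.1 * z.2.2 * w) * (z.2.1 + ocfE z.1 * z.2.2 * w')) =
          |w - w'| := by
  have hg1 : g < 1 := by nlinarith
  induction n with
  | zero =>
    refine ⟨id, rfl, fun w hw => ⟨hw, rfl⟩, ?_⟩
    rintro w - w' - z rfl
    simp
  | succ n ih =>
    obtain ⟨M, hM1, hM2, hM3⟩ := ih
    have hst := (isOddDenState_init hg1 hx hm).iterate hg hg2 n
    have hfst : ((ocfStep 1)^[n] (x, 1, 0)).1 = (ocfMap 1)^[n] x := ocfStep_iterate_fst _ _ _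
    have hti : Irrational ((ocfMap 1)^[n] x) := hx.ocfMap_iterate n
    have htm : (ocfMap 1)^[n] x ∈ Ico (-1 : ℝ) 1 := hfst ▸ hst.mem
    generalize ht : (ocfMap 1)^[n] x = t at *
    have hti' : Irrational (ocfMap 1 t) := hti.ocfMap
    -- The inverse branch of one more application of the map, with the digit and sign read off the
    -- orbit of `x`.
    set ψ : ℝ → ℝ := fun w => 1 / ((ocfD 1 t : ℝ) + ocfE (ocfMap 1 t) * w) with hψ
    have hψm : ∀ w ∈ oddSet, ψ w ∈ oddSet := fun w hw =>
      (branch_mem_oddSet (odd_ocfD 1 t) (ocfE_eq_one_or hti'.ne_zero) hw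
        (one_lt_ocfD_add hti htm hw)).1
    refine ⟨fun w => M (ψ w), ?_, fun w hw => ⟨(hM2 _ (hψm w hw)).1, ?_⟩, ?_⟩
    · rw [Function.iterate_succ_apply', ht, ← hM1]
      simp only [hψ]
      rw [ocfE_mul_abs hti'.ne_zero, ocfMap_eq hti.ne_zero, add_sub_cancel, one_div_one_div]
    · rw [Function.iterate_succ_apply', (hM2 _ (hψm w hw)).2]
      exact branch_oddFold (odd_ocfD 1 t) (ocfE_eq_one_or hti'.ne_zero) hw
        (one_lt_ocfD_add hti htm hw)
    · rintro w hw w' hw' z rfl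
      have key := hM3 _ (hψm w hw) _ (hψm w' hw') _ rfl
      rw [Function.iterate_succ_apply']
      generalize (ocfStep 1)^[n] (x, 1, 0) = z at *
      obtain ⟨z₁, u, v⟩ := z
      simp only at hfst
      subst hfst
      have p := one_lt_ocfD_add hti htm hw
      have p' := one_lt_ocfD_add hti htm hw'
      have hd : |ψ w - ψ w'| * (((ocfD 1 z₁ : ℝ) + ocfE (ocfMap 1 z₁) * w) *
          ((ocfD 1 z₁ : ℝ) + ocfE (ocfMap 1 z₁) * w')) = |w - w'| := by
        have e : ψ w - ψ w' = (ocfE (ocfMap 1 z₁) * (w' - w)) /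
            (((ocfD 1 z₁ : ℝ) + ocfE (ocfMap 1 z₁) * w) *
              ((ocfD 1 z₁ : ℝ) + ocfE (ocfMap 1 z₁) * w')) := by
          simp only [hψ]
          rw [div_sub_div _ _ (by linarith) (by linarith)]
          congr 1
          ring
        have pp : 0 < ((ocfD 1 z₁ : ℝ) + ocfE (ocfMap 1 z₁) * w) *
              ((ocfD 1 z₁ : ℝ) + ocfE (ocfMap 1 z₁) * w') :=
          mul_pos (by linarith) (by linarith)
        have he : |(ocfE (ocfMap 1 z₁) : ℝ)| = 1 := by
          rcases ocfE_eq_one_or hti'.ne_zero with h | h <;> rw [h] <;> simp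
        rw [e, abs_div, abs_of_pos pp, div_mul_cancel₀ _ pp.ne', abs_mul, he, one_mul, abs_sub_comm]
      rw [← hd, ← key]
      simp only [ocfStep]
      have e1 : ∀ y : ℝ, 1 < (ocfD 1 z₁ : ℝ) + ocfE (ocfMap 1 z₁) * y →
          (ocfD 1 z₁ * u + ocfE z₁ * v + ocfE (ocfMap 1 z₁) * u * y : ℝ) =
            (u + ocfE z₁ * v * ψ y) * ((ocfD 1 z₁ : ℝ) + ocfE (ocfMap 1 z₁) * y) := by
        intro y hy
        simp only [hψ]
        field_simp [(by linarith : (ocfD 1 z₁ : ℝ) + ocfE (ocfMap 1 z₁) * y ≠ 0)]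
        ring
      rw [e1 w p, e1 w' p']
      ring

/-- Quantitative expansion: an invariant set occupies a definite proportion of small balls. -/
theorem volume_inter_oddSet_le {g x : ℝ} (hg : 0 < g) (hg2 : g ^ 2 + g = 1) (hx : x ∈ oddSet)
    {A : Set ℝ} (hinv : oddFold ⁻¹' A = A) (n : ℕ) {u : ℝ}
    (hu : u = ((ocfStep 1)^[n] (x, 1, 0)).2.1) :
    volume (A ∩ oddSet) ≤ ENNReal.ofReal (((1 + g⁻¹) * u) ^ 2) *
      volume (A ∩ Metric.closedBall x (1 / (g * u) ^ 2)) := by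
  have hg1 : g < 1 := by nlinarith
  have hm : x ∈ Ico (-1 : ℝ) 1 := ⟨by linarith [hx.1.1], hx.1.2⟩
  obtain ⟨M, hM1, hM2, hM3⟩ := exists_inverse_branch hg hg2 hx.2 hm n
  have hst := (isOddDenState_init hg1 hx.2 hm).iterate hg hg2 n
  have hfst : ((ocfStep 1)^[n] (x, 1, 0)).1 = (ocfMap 1)^[n] x := ocfStep_iterate_fst _ _ _
  have hT : |(ocfMap 1)^[n] x| ∈ oddSet :=
    mem_oddSet_abs (hfst ▸ hst.irr) (hfst ▸ hst.mem)
  have hM3' := fun w hw w' hw' => hM3 w hw w' hw' _ rfl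
  have hb : ∀ w ∈ oddSet, _ := fun w hw =>
    mul_le_add_mul_of_state (w := w) hg hg1.le hst ⟨hw.1.1.le, hw.1.2.le⟩
  have hu0 : 0 < u := hu ▸ hst.pos
  rw [← hu] at hb hM3'
  have hgu : 0 < g * u := by positivity
  have hupper : ∀ w ∈ oddSet, ∀ w' ∈ oddSet, |M w - M w'| * (g * u) ^ 2 ≤ |w - w'| := by
    intro w hw w' hw'
    rw [← hM3' w hw w' hw', pow_two]
    exact mul_le_mul_of_nonneg_left (mul_le_mul (hb w hw).1 (hb w' hw').1 hgu.le
      (hgu.le.trans (hb w hw).1)) (abs_nonneg _)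
  have hlower : ∀ w ∈ oddSet, ∀ w' ∈ oddSet,
      |w - w'| ≤ ((1 + g⁻¹) * u) ^ 2 * |M w - M w'| := by
    intro w hw w' hw'
    rw [← hM3' w hw w' hw', pow_two, mul_comm _ |M w - M w'|]
    exact mul_le_mul_of_nonneg_left (mul_le_mul (hb w hw).2 (hb w' hw').2
      (hgu.le.trans (hb w' hw').1) (by positivity)) (abs_nonneg _)
  have hinvn : ∀ y, oddFold^[n] y ∈ A → y ∈ A := by
    intro y hy
    have : (oddFold^[n]) ⁻¹' A = A := by
      rw [Set.preimage_iterate_eq]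
      exact Function.IsFixedPt.iterate (f := preimage oddFold) hinv n
    rw [← this]
    exact hy
  set S := A ∩ oddSet with hS
  have himg : oddFold^[n] '' (M '' S) = S := by
    rw [image_image]
    ext y
    constructor
    · rintro ⟨w, hw, rfl⟩
      simp only
      rw [(hM2 w hw.2).2]
      exact hw
    · intro hy
      exact ⟨y, hy, (hM2 y hy.2).2⟩
  have hsub : M '' S ⊆ A ∩ Metric.closedBall x (1 / (g * u) ^ 2) := by
    rintro _ ⟨w, hw, rfl⟩
    refine ⟨hinvn _ ((hM2 w hw.2).2.symm ▸ hw.1), ?_⟩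
    rw [Metric.mem_closedBall, Real.dist_eq, le_div_iff₀ (by positivity)]
    have h1 := hupper w hw.2 _ hT
    rw [hM1, abs_of_pos hx.1.1] at h1
    refine h1.trans ?_
    rw [abs_le]
    constructor <;> linarith [hw.2.1.1, hw.2.1.2, hT.1.1, hT.1.2]
  -- On the image of the branch the iterate inverts `M`, so the lower distance bound is a Lipschitz
  -- bound for it. One-dimensional Hausdorff measure converts this into a volume bound without
  -- differentiating.
  have hlip : LipschitzOnWith (Real.toNNReal (((1 + g⁻¹) * u) ^ 2)) (oddFold^[n]) (M '' S) := by
    refine LipschitzOnWith.of_dist_le_mul ?_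
    rintro _ ⟨w, hw, rfl⟩ _ ⟨w', hw', rfl⟩
    rw [(hM2 w hw.2).2, (hM2 w' hw'.2).2, Real.dist_eq, Real.dist_eq,
      Real.coe_toNNReal _ (by positivity)]
    exact hlower w hw.2 w' hw'.2
  have h := hlip.hausdorffMeasure_image_le (d := 1) zero_le_one
  rw [himg, hausdorffMeasure_real, ENNReal.rpow_one] at h
  exact h.trans (mul_le_mul_right (measure_mono hsub) _)

/-- If `A` has positive measure, it fills a fixed proportion of arbitrarily small balls around every
point of `oddSet`, so no such point is a Lebesgue density point of the complement. -/
theorem volume_oddSet_diff_eq_zero {g : ℝ} (hg : 0 < g) (hg2 : g ^ 2 + g = 1)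
    {A : Set ℝ} (hA : MeasurableSet A) (hinv : oddFold ⁻¹' A = A)
    (h0 : volume (A ∩ oddSet) ≠ 0) : volume (Aᶜ ∩ oddSet) = 0 := by
  have hg1 : g < 1 := by nlinarith
  have hdens := IsUnifLocDoublingMeasure.ae_tendsto_measure_inter_div (volume : Measure ℝ) Aᶜ 1
  rw [ae_restrict_iff' hA.compl] at hdens
  have : ∀ᵐ x : ℝ, x ∉ Aᶜ ∩ oddSet := by
    filter_upwards [hdens] with x hx ⟨hxA, hxo⟩
    have hm : x ∈ Ico (-1 : ℝ) 1 := ⟨by linarith [hxo.1.1], hxo.1.2⟩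
    -- Only even times are used, since the growth estimate for denominators covers two steps at
    -- once.
    set u : ℕ → ℝ := fun n => ((ocfStep 1)^[2 * n] (x, 1, 0)).2.1 with hu
    have hst := isOddDenState_init hg1 hxo.2 hm
    have hu1 : ∀ n, (1 + g) ^ n ≤ u n := fun n => by
      simpa using hst.pow_le_iterate hg hg2 n
    have hupos : ∀ n, 0 < u n := fun n => lt_of_lt_of_le (by positivity) (hu1 n)
    have hutop : Tendsto u atTop atTop :=
      tendsto_atTop_mono hu1 (tendsto_pow_atTop_atTop_of_one_lt (by linarith))
    set δ : ℕ → ℝ := fun n => 1 / (g * u n) ^ 2 with hδ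
    have hδpos : ∀ n, 0 < δ n := fun n => by
      have := hupos n
      simp only [hδ]
      positivity
    have hδlim : Tendsto δ atTop (𝓝[>] 0) := by
      refine tendsto_nhdsWithin_iff.2 ⟨?_, Eventually.of_forall hδpos⟩
      simp only [hδ, one_div]
      exact ((tendsto_pow_atTop two_ne_zero).comp (hutop.const_mul_atTop hg)).inv_tendsto_atTop
    have hlim := hx hxA (fun _ => x) δ hδlim (Eventually.of_forall fun n =>
      Metric.mem_closedBall_self (by rw [one_mul]; exact (hδpos n).le))
    -- The Lipschitz constant `((1+g⁻¹) u)²` times the ball length `2/(g u)²`; the denominator `u`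
    -- cancels.
    set K : ENNReal := ENNReal.ofReal (2 * (1 + g⁻¹) ^ 2 / g ^ 2) with hK
    have hK0 : K ≠ ⊤ := ENNReal.ofReal_ne_top
    have hcle : ∀ n, volume (Aᶜ ∩ Metric.closedBall x (δ n)) / volume (Metric.closedBall x (δ n))
        + volume (A ∩ oddSet) / K ≤ 1 := by
      intro n
      have hun := hupos n
      have hV0 : volume (Metric.closedBall x (δ n)) ≠ 0 := by
        rw [Real.volume_closedBall]
        simpa using hδpos n
      have hVt : volume (Metric.closedBall x (δ n)) ≠ ⊤ := by
        rw [Real.volume_closedBall]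
        exact ENNReal.ofReal_ne_top
      have h1 := volume_inter_oddSet_le hg hg2 hxo hinv (2 * n) (u := u n) rfl
      have h2 : volume (A ∩ oddSet) / K ≤
          volume (A ∩ Metric.closedBall x (δ n)) / volume (Metric.closedBall x (δ n)) := by
        have hKe : K = ENNReal.ofReal (((1 + g⁻¹) * u n) ^ 2) *
            volume (Metric.closedBall x (δ n)) := by
          rw [hK, Real.volume_closedBall, ← ENNReal.ofReal_mul (by positivity)]
          congr 1
          simp only [hδ]
          have := hun.ne'
          field_simp
        have hp : ENNReal.ofReal (((1 + g⁻¹) * u n) ^ 2) ≠ 0 := by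
          have : 0 < ((1 + g⁻¹) * u n) ^ 2 := by positivity
          exact (ENNReal.ofReal_pos.2 this).ne'
        rw [hKe, ENNReal.div_eq_inv_mul, ENNReal.mul_inv (Or.inl hp) (Or.inl ENNReal.ofReal_ne_top),
          mul_comm (ENNReal.ofReal _)⁻¹, mul_assoc, ENNReal.div_eq_inv_mul]
        refine mul_le_mul_right ?_ _
        rw [← ENNReal.div_eq_inv_mul]
        refine ENNReal.div_le_of_le_mul ?_
        rw [mul_comm]
        exact h1
      calc _ ≤ volume (Aᶜ ∩ Metric.closedBall x (δ n)) / volume (Metric.closedBall x (δ n)) +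
            volume (A ∩ Metric.closedBall x (δ n)) / volume (Metric.closedBall x (δ n)) :=
            add_le_add_right h2 _
        _ = 1 := by
            rw [← ENNReal.add_div, inter_comm Aᶜ, inter_comm A, add_comm,
              ← Set.sdiff_eq, measure_inter_add_sdiff _ hA, ENNReal.div_self hV0 hVt]
    have hc0 : volume (A ∩ oddSet) / K ≠ 0 := by
      rw [Ne, ENNReal.div_eq_zero_iff]
      exact not_or.2 ⟨h0, hK0⟩
    have hle : 1 + volume (A ∩ oddSet) / K ≤ 1 :=
      le_of_tendsto' (hlim.add_const _) hcle
    have : 1 + volume (A ∩ oddSet) / K ≤ 1 + 0 := by simpa using hle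
    rw [ENNReal.add_le_add_iff_left ENNReal.one_ne_top] at this
    exact hc0 (le_antisymm this bot_le)
  exact measure_eq_zero_iff_ae_notMem.2 this

theorem ergodic_oddFold {g : ℝ} (hg : 0 < g) (hg2 : g ^ 2 + g = 1) :
    Ergodic oddFold (oddMeasure g) := by
  refine ⟨measurePreserving_oddFold hg hg2, ⟨fun A hA hinv => ?_⟩⟩
  have hac : oddMeasure g ≪ volume.restrict oddSet := withDensity_absolutelyContinuous _ _
  rw [eventuallyConst_set]
  by_cases h : volume (A ∩ oddSet) = 0
  · right
    refine hac.ae_le ?_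
    refine measure_eq_zero_iff_ae_notMem.1 ?_
    rwa [Measure.restrict_apply hA]
  · left
    refine hac.ae_le ?_
    have := volume_oddSet_diff_eq_zero hg hg2 hA hinv h
    change volume.restrict oddSet Aᶜ = 0
    rwa [Measure.restrict_apply hA.compl]

end OddFoldErgodicity

/-! ### The almost sure average of `log` along the folded map. -/

section OddFoldLimit

open Set MeasureTheory Filter Topology

theorem oddDensity_pos {g u : ℝ} (hg : 0 < g) (hu : u ∈ Icc (0 : ℝ) 1) : 0 < oddDensity g u := by
  have h1 : 0 < u + g := by linarith [hu.1]
  have h2 : 0 < g + 2 - u := by linarith [hu.2]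
  unfold oddDensity
  positivity

theorem measurable_oddDensity (g : ℝ) : Measurable (oddDensity g) := by
  unfold oddDensity
  fun_prop

theorem integral_oddDensity {g : ℝ} (hg : 0 < g) (hg2 : g ^ 2 + g = 1) :
    ∫ u in (0 : ℝ)..1, oddDensity g u = -(3 * Real.log g) := by
  have hg1 : g < 1 := by nlinarith
  have hd : ∀ u ∈ uIcc (0 : ℝ) 1,
      HasDerivAt (fun u => Real.log (u + g) - Real.log (g + 2 - u)) (oddDensity g u) u := by
    intro u hu
    rw [uIcc_of_le zero_le_one] at hu
    have h1 : u + g ≠ 0 := by linarith [hu.1]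
    have h2 : g + 2 - u ≠ 0 := by linarith [hu.2]
    have := (((hasDerivAt_id u).add_const g).log h1).sub
      (((hasDerivAt_id u).const_sub (g + 2)).log h2)
    refine this.congr_deriv ?_
    simp only [id, oddDensity]
    ring
  rw [intervalIntegral.integral_eq_sub_of_hasDerivAt hd
    ((continuousOn_oddDensity hg).intervalIntegrable_of_Icc zero_le_one)]
  have e1 : g + 2 - 1 = 1 + g := by ring
  have e2 : g + 2 = (g ^ 2)⁻¹ := by
    refine eq_inv_of_mul_eq_one_left ?_
    linear_combination (g + 1) * hg2
  rw [e1, sub_self, zero_add, sub_zero, e2, Real.log_inv, Real.log_pow]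
  push_cast
  ring

theorem integral_oddMeasure {g : ℝ} (hg : 0 < g) (f : ℝ → ℝ) :
    ∫ u, f u ∂(oddMeasure g) = ∫ u in (0 : ℝ)..1, f u * oddDensity g u := by
  rw [oddMeasure, integral_withDensity_eq_integral_toReal_smul
    (measurable_oddDensity g).ennreal_ofReal (by simp),
    setIntegral_congr_set oddSet_ae_eq, intervalIntegral.integral_of_le zero_le_one,
    integral_Ioc_eq_integral_Ioo]
  refine setIntegral_congr_fun measurableSet_Ioo fun u hu => ?_
  simp only [smul_eq_mul]
  rw [ENNReal.toReal_ofReal (oddDensity_pos hg ⟨hu.1.le, hu.2.le⟩).le, mul_comm]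

theorem integrable_oddMeasure {g : ℝ} (hg : 0 < g) {f : ℝ → ℝ}
    (hf : IntervalIntegrable (fun u => f u * oddDensity g u) volume 0 1) :
    Integrable f (oddMeasure g) := by
  rw [oddMeasure, integrable_withDensity_iff (measurable_oddDensity g).ennreal_ofReal (by simp),
    Measure.restrict_congr_set oddSet_ae_eq]
  rw [intervalIntegrable_iff_integrableOn_Ioo_of_le zero_le_one] at hf
  refine hf.congr_fun (fun u hu => ?_) measurableSet_Ioo
  simp only
  rw [ENNReal.toReal_ofReal (oddDensity_pos hg ⟨hu.1.le, hu.2.le⟩).le]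

/-- Almost sure limit of the Birkhoff averages of `log` for the folded odd continued fraction map. -/
theorem ae_tendsto_birkhoffSum_oddFold {g : ℝ} (hg : 0 < g) (hg2 : g ^ 2 + g = 1) :
    ∀ᵐ w : ℝ, w ∈ Ioo (0 : ℝ) 1 →
      Tendsto (fun n : ℕ => (1 / (n : ℝ)) * birkhoffSum oddFold Real.log n w) atTop
        (𝓝 (Real.pi ^ 2 / (18 * Real.log g))) := by
  have hg1 : g < 1 := by nlinarith
  have hlog : Real.log g < 0 := Real.log_neg hg hg1
  have hint1 : Integrable (fun _ : ℝ => (1 : ℝ)) (oddMeasure g) := by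
    refine integrable_oddMeasure hg ?_
    simp only [one_mul]
    exact (continuousOn_oddDensity hg).intervalIntegrable_of_Icc zero_le_one
  have hfin : IsFiniteMeasure (oddMeasure g) := by
    rcases (integrable_const_iff (c := (1 : ℝ))).1 hint1 with h | h
    · exact absurd h one_ne_zero
    · exact h
  have hmass : (oddMeasure g univ).toReal = -(3 * Real.log g) := by
    have h1 := integral_oddMeasure hg (fun _ => (1 : ℝ))
    simp only [one_mul, integral_oddDensity hg hg2] at h1
    rw [← h1]
    simp [Measure.real]
  have hm0 : oddMeasure g univ ≠ 0 := by
    intro h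
    rw [h, ENNReal.toReal_zero] at hmass
    linarith
  set P : Measure ℝ := (oddMeasure g univ)⁻¹ • oddMeasure g with hP
  have hprob : IsProbabilityMeasure P := by
    refine ⟨?_⟩
    rw [hP, Measure.smul_apply, smul_eq_mul, ENNReal.inv_mul_cancel hm0 (measure_ne_top _ _)]
  have herg : Ergodic oddFold P := (ergodic_oddFold hg hg2).smul_measure _
  have hintlog : Integrable Real.log P :=
    (integrable_oddMeasure hg (intervalIntegrable_log_mul_oddDensity hg)).smul_measure
      (ENNReal.inv_ne_top.2 hm0)
  have hb := herg.ae_tendsto_birkhoffSum_div Real.measurable_log hintlog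
  have hval : ∫ x, Real.log x ∂P = Real.pi ^ 2 / (18 * Real.log g) := by
    rw [hP, integral_smul_measure, integral_oddMeasure hg, integral_log_mul_oddDensity hg hg2,
      ENNReal.toReal_inv, hmass, smul_eq_mul]
    have := hlog.ne
    field_simp
    norm_num
  rw [hval] at hb
  have hb2 : ∀ᵐ w ∂(oddMeasure g), Tendsto (fun n : ℕ =>
      (1 / (n : ℝ)) * birkhoffSum oddFold Real.log n w) atTop
        (𝓝 (Real.pi ^ 2 / (18 * Real.log g))) := by
    have hc : (oddMeasure g univ)⁻¹ ≠ 0 := ENNReal.inv_ne_zero.2 (measure_ne_top _ _)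
    exact (Measure.absolutelyContinuous_smul hc).ae_le hb
  -- The density is positive, so null sets of the invariant measure are Lebesgue null in `(0,1)`.
  have hac : volume.restrict oddSet ≪ oddMeasure g := by
    refine withDensity_absolutelyContinuous' (measurable_oddDensity g).ennreal_ofReal.aemeasurable ?_
    rw [ae_restrict_iff' measurableSet_oddSet]
    refine Eventually.of_forall fun u hu => ?_
    exact (ENNReal.ofReal_pos.2 (oddDensity_pos hg ⟨hu.1.1.le, hu.1.2.le⟩)).ne'
  have hb3 := hac.ae_le hb2
  rw [Measure.restrict_congr_set oddSet_ae_eq] at hb3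
  exact (ae_restrict_iff' measurableSet_Ioo).1 hb3

end OddFoldLimit

/-! ### Coupling the `α`-expansion with the expansion for the parameter `1`. -/

section Coupling

open Set

variable {α : ℝ}

/-- The relation between the orbits for a parameter `α ≤ 1` and for the parameter `1`. -/
inductive OcfRelLow (α : ℝ) : ℝ × ℝ × ℝ → ℝ × ℝ × ℝ → Prop
  | eq (z : ℝ × ℝ × ℝ) : OcfRelLow α z z
  | shift (t u v : ℝ) (ht : t ∈ Ico α 1) : OcfRelLow α (t - 2, u + 2 * v, v) (t, u, v)
  | inv (t u v : ℝ) (ht : t ∈ Ioo (0 : ℝ) 1) :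
      OcfRelLow α (-t / (1 + 2 * t), u, 2 * u - v) (t, u, v)

/-- The relation between the orbits for a parameter `α ≥ 1` and for the parameter `1`. -/
inductive OcfRelHigh (α : ℝ) : ℝ × ℝ × ℝ → ℝ × ℝ × ℝ → Prop
  | eq (z : ℝ × ℝ × ℝ) : OcfRelHigh α z z
  | shift (y u v : ℝ) (hy : y ∈ Ico 1 α) : OcfRelHigh α (y, u - 2 * v, v) (y - 2, u, v)
  | inv (t u v : ℝ) (ht : t ∈ Ioo (0 : ℝ) 1) :
      OcfRelHigh α (-t / (1 + 2 * t), u, 2 * u - v) (t, u, v)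
  | invShift (y u v : ℝ) (hy : y ∈ Ico 1 α) :
      OcfRelHigh α (-y / (1 + 2 * y), u - 2 * v, 2 * u - 5 * v) (y - 2, u, v)

theorem odd_digit_low {d d' : ℤ} {y : ℝ} (hα : 1 / 2 < α) (hα1 : α ≤ 1) (hd : Odd d) (hd' : Odd d')
    (h : y - d ∈ Ico (α - 2) α) (h' : y - d' ∈ Ico (-1 : ℝ) 1) :
    d = d' ∨ d = d' + 2 ∧ y - d' ∈ Ico α 1 := by
  obtain ⟨k, rfl⟩ := hd
  obtain ⟨l, rfl⟩ := hd'
  push_cast at h h' ⊢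
  have h1 : (k : ℝ) < l + 2 := by linarith [h.1, h.2, h'.1, h'.2]
  have h2 : (l : ℝ) < k + 1 := by linarith [h.1, h.2, h'.1, h'.2]
  have h1' : k < l + 2 := by exact_mod_cast h1
  have h2' : l < k + 1 := by exact_mod_cast h2
  rcases (by omega : k = l ∨ k = l + 1) with rfl | rfl
  · left; rfl
  · right
    push_cast at h
    exact ⟨by ring, by linarith [h.1], h'.2⟩

theorem odd_digit_high {d d' : ℤ} {y : ℝ} (hα : 1 ≤ α) (hα2 : α < 2) (hd : Odd d) (hd' : Odd d')
    (h : y - d ∈ Ico (α - 2) α) (h' : y - d' ∈ Ico (-1 : ℝ) 1) :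
    d = d' ∨ d' = d + 2 ∧ y - d ∈ Ico 1 α := by
  obtain ⟨k, rfl⟩ := hd
  obtain ⟨l, rfl⟩ := hd'
  push_cast at h h' ⊢
  have h1 : (l : ℝ) < k + 2 := by linarith [h.1, h.2, h'.1, h'.2]
  have h2 : (k : ℝ) < l + 1 := by linarith [h.1, h.2, h'.1, h'.2]
  have h1' : l < k + 2 := by exact_mod_cast h1
  have h2' : k < l + 1 := by exact_mod_cast h2
  rcases (by omega : l = k ∨ l = k + 1) with rfl | rfl
  · left; rfl
  · right
    push_cast at h'
    exact ⟨by ring, by linarith [h'.1], h.2⟩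

theorem neg_div_facts {t : ℝ} (ht : 0 < t) :
    -t / (1 + 2 * t) < 0 ∧ 1 / |-t / (1 + 2 * t)| = 1 / t + 2 := by
  have h : -t / (1 + 2 * t) < 0 := div_neg_of_neg_of_pos (by linarith) (by linarith)
  refine ⟨h, ?_⟩
  rw [abs_of_neg h]
  field_simp

theorem ocfMap_one_sub_mem {t : ℝ} (ht : t ≠ 0) :
    1 / |t| - (ocfD 1 t : ℝ) ∈ Ico (-1 : ℝ) 1 := by
  have := ocfMap_mem (α := 1) ht
  rw [ocfMap_eq ht] at this
  norm_num at this ⊢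
  exact this

/-- A discrepancy starts when the `1`-orbit lands in `[α, 1)`, where the `α`-digit is larger by `2`
(`shift`). Both next digits are then `1`, which leads to `inv`; there `1/|x| = 1/t + 2`, so the
orbits merge again or a new `shift` starts. -/
theorem OcfRelLow.step (hα : 1 / 2 < α) (hα1 : α ≤ 1) {z z' : ℝ × ℝ × ℝ} (h : OcfRelLow α z z')
    (hirr : Irrational z'.1) : OcfRelLow α (ocfStep α z) (ocfStep 1 z') := by
  rcases h with ⟨t, u, v⟩ | ⟨t, u, v, ht⟩ | ⟨t, u, v, ht⟩
  · have h0 : t ≠ 0 := hirr.ne_zero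
    have h1 := ocfMap_mem (α := α) h0
    rw [ocfMap_eq h0] at h1
    have key := odd_digit_low hα hα1 (odd_ocfD α t) (odd_ocfD 1 t) h1 (ocfMap_one_sub_mem h0)
    simp only [ocfStep, ocfMap_eq h0]
    rcases key with e | ⟨e, hm⟩
    · rw [e]
      exact OcfRelLow.eq _
    · rw [e]
      convert OcfRelLow.shift (α := α) _ (ocfD 1 t * u + ocfE t * v) u hm using 2
      · push_cast; ring
      · congr 1
        push_cast; ring
  · have t0 : 0 < t := by linarith [ht.1]
    have ht1 : t - 2 < 0 := by linarith [ht.2]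
    have p : 0 < 2 - t := by linarith
    have q0 : 0 < 1 / (2 - t) := by positivity
    have q1 : 1 / (2 - t) < 1 := by
      rw [div_lt_one p]; linarith [ht.2]
    have q2 : 1 / t < 2 := by
      rw [div_lt_iff₀ t0]; linarith [ht.1]
    have q3 : 1 < 1 / t := by
      rw [lt_div_iff₀ t0]; linarith [ht.2]
    have e1 : ocfD α (t - 2) = 1 := ocfD_eq_of_mem ht1.ne odd_one (by
      rw [abs_of_neg ht1, neg_sub]
      push_cast
      constructor <;> linarith)
    have e2 : ocfD 1 t = 1 := ocfD_eq_of_mem t0.ne' odd_one (by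
      rw [abs_of_pos t0]
      push_cast
      constructor <;> linarith)
    simp only [ocfStep, ocfMap_eq ht1.ne, ocfMap_eq t0.ne', e1, e2, ocfE_of_neg ht1,
      ocfE_of_pos t0, abs_of_neg ht1, abs_of_pos t0]
    push_cast
    have hm : 1 / t - 1 ∈ Ioo (0 : ℝ) 1 := ⟨by linarith, by linarith⟩
    convert OcfRelLow.inv (α := α) _ (1 * u + 1 * v) u hm using 2
    · have : t + 2 * (1 - t) ≠ 0 := by linarith
      rw [neg_sub]
      field_simp
      ring
    · congr 1 <;> ring
  · obtain ⟨hx, hinv⟩ := neg_div_facts ht.1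
    have h1 := ocfMap_mem (α := α) hx.ne
    have h2 := ocfMap_one_sub_mem ht.1.ne'
    simp only [ocfStep]
    rw [ocfMap_eq hx.ne, hinv] at h1 ⊢
    rw [abs_of_pos ht.1] at h2
    rw [ocfMap_eq ht.1.ne', abs_of_pos ht.1, ocfE_of_pos ht.1, ocfE_of_neg hx]
    have hodd := odd_ocfD α (-t / (1 + 2 * t))
    generalize ocfD α (-t / (1 + 2 * t)) = d at *
    -- The reciprocals differ by `2`, so `d - 2` is compared with the digit of `t`.
    have key := odd_digit_low (d := d - 2) (y := 1 / t) hα hα1 (hodd.sub_even even_two)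
      (odd_ocfD 1 t) (by push_cast; convert h1 using 1; ring) h2
    rcases key with e | ⟨e, hm⟩
    · have e' : d = ocfD 1 t + 2 := by omega
      rw [e']
      convert OcfRelLow.eq (α := α) _ using 2
      · push_cast; ring
      · congr 1
        push_cast; ring
    · have e' : d = ocfD 1 t + 4 := by omega
      rw [e']
      convert OcfRelLow.shift (α := α) _ (ocfD 1 t * u + (1 : ℤ) * v) u hm using 2
      · push_cast; ring
      · congr 1
        push_cast; ring

/-- The bound `α (α - 1) ≤ 1` gives `1/y > α - 1`, so the `α`-digit of `y` is `1`, and `1/(2 - y) -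
1 < α`. The digit of `y - 2` is `1` or `3` according to whether the latter quantity is below `1`;
these cases are `inv` and `invShift`. -/
theorem OcfRelHigh.step_shift (hα : 1 ≤ α) (hα2 : α * (α - 1) ≤ 1) {y : ℝ} (u v : ℝ)
    (hy : y ∈ Ico 1 α) (hirr : Irrational (y - 2)) :
    1 / y - 1 ∈ Ico (α - 2) α ∧
      OcfRelHigh α (1 / y - 1, u - v, u - 2 * v) (ocfStep 1 (y - 2, u, v)) := by
  have hα3 : α < 2 := by nlinarith
  have y0 : 0 < y := by linarith [hy.1]
  have p : 0 < 2 - y := by linarith [hy.2]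
  have ht : y - 2 < 0 := by linarith
  have h1 : 1 / y ≤ 1 := by rw [div_le_one y0]; exact hy.1
  have h2 : α - 1 < 1 / y := by
    rw [lt_div_iff₀ y0]
    rcases hα.eq_or_lt with rfl | h
    · simp
    · nlinarith [hy.2]
  refine ⟨⟨by linarith, by linarith⟩, ?_⟩
  have hy1 : y ≠ 1 := by
    rintro rfl
    exact hirr.ne_int (-1) (by norm_num)
  have hy1' : 1 < y := lt_of_le_of_ne hy.1 hy1.symm
  have r0 : 0 < 1 / (2 - y) - 1 := by
    rw [sub_pos, lt_div_iff₀ p]; linarith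
  have rα : 1 / (2 - y) - 1 < α := by
    rw [sub_lt_iff_lt_add, div_lt_iff₀ p]
    nlinarith [hy.2]
  rcases lt_or_ge (1 / (2 - y) - 1) 1 with r1 | r1
  · have e : ocfD 1 (y - 2) = 1 := ocfD_eq_of_mem ht.ne odd_one (by
      rw [abs_of_neg ht, neg_sub]
      push_cast
      constructor <;> linarith)
    simp only [ocfStep, ocfMap_eq ht.ne, e, ocfE_of_neg ht, abs_of_neg ht, neg_sub]
    push_cast
    convert OcfRelHigh.inv (α := α) _ (1 * u + -1 * v) u ⟨r0, r1⟩ using 2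
    · have : 2 - y + 2 * (1 - (2 - y)) ≠ 0 := by linarith
      field_simp
      ring
    · congr 1 <;> ring
  · have e : ocfD 1 (y - 2) = 3 := ocfD_eq_of_mem ht.ne (by decide) (by
      rw [abs_of_neg ht, neg_sub]
      push_cast
      constructor <;> linarith)
    simp only [ocfStep, ocfMap_eq ht.ne, e, ocfE_of_neg ht, abs_of_neg ht, neg_sub]
    push_cast
    convert OcfRelHigh.invShift (α := α) _ (3 * u + -1 * v) u ⟨r1, rα⟩ using 2
    · have : 2 - y + 2 * (1 - (2 - y)) ≠ 0 := by linarith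
      field_simp
      ring
    · congr 1 <;> ring1
    · ring1

/-- The states `shift` and `invShift` have the same successor, so both reduce to
`OcfRelHigh.step_shift`; `invShift` is `inv` applied on top of `shift`. -/
theorem OcfRelHigh.step (hα : 1 ≤ α) (hα2 : α * (α - 1) ≤ 1) {z z' : ℝ × ℝ × ℝ}
    (h : OcfRelHigh α z z') (hirr : Irrational z'.1) :
    OcfRelHigh α (ocfStep α z) (ocfStep 1 z') := by
  have hα3 : α < 2 := by nlinarith
  rcases h with ⟨t, u, v⟩ | ⟨y, u, v, hy⟩ | ⟨t, u, v, ht⟩ | ⟨y, u, v, hy⟩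
  · have h0 : t ≠ 0 := hirr.ne_zero
    have h1 := ocfMap_mem (α := α) h0
    rw [ocfMap_eq h0] at h1
    have key := odd_digit_high hα hα3 (odd_ocfD α t) (odd_ocfD 1 t) h1 (ocfMap_one_sub_mem h0)
    simp only [ocfStep, ocfMap_eq h0]
    rcases key with e | ⟨e, hm⟩
    · rw [e]
      exact OcfRelHigh.eq _
    · rw [e]
      convert OcfRelHigh.shift (α := α) _ ((ocfD α t + 2 : ℤ) * u + ocfE t * v) u hm using 2
      · congr 1
        push_cast; ring
      · push_cast; ring
  · obtain ⟨hm, hrel⟩ := OcfRelHigh.step_shift hα hα2 u v hy hirr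
    have y0 : 0 < y := by linarith [hy.1]
    have e : ocfD α y = 1 := ocfD_eq_of_mem y0.ne' odd_one (by
      rw [abs_of_pos y0]; push_cast; exact hm)
    convert hrel using 1
    simp only [ocfStep, ocfMap_eq y0.ne', e, ocfE_of_pos y0, abs_of_pos y0]
    push_cast
    congr 2
    ring
  · obtain ⟨hx, hinv⟩ := neg_div_facts ht.1
    have h1 := ocfMap_mem (α := α) hx.ne
    have h2 := ocfMap_one_sub_mem ht.1.ne'
    simp only [ocfStep]
    rw [ocfMap_eq hx.ne, hinv] at h1 ⊢
    rw [abs_of_pos ht.1] at h2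
    rw [ocfMap_eq ht.1.ne', abs_of_pos ht.1, ocfE_of_pos ht.1, ocfE_of_neg hx]
    have hodd := odd_ocfD α (-t / (1 + 2 * t))
    generalize ocfD α (-t / (1 + 2 * t)) = d at *
    have key := odd_digit_high (d := d - 2) (y := 1 / t) hα hα3 (hodd.sub_even even_two)
      (odd_ocfD 1 t) (by push_cast; convert h1 using 1; ring) h2
    rcases key with e | ⟨e, hm⟩
    · have e' : d = ocfD 1 t + 2 := by omega
      rw [e']
      convert OcfRelHigh.eq (α := α) _ using 2
      · push_cast; ring
      · congr 1
        push_cast; ring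
    · have e' : ocfD 1 t = d := by omega
      rw [e']
      convert OcfRelHigh.shift (α := α) _ (d * u + (1 : ℤ) * v) u hm using 2
      · push_cast; ring
      · congr 1
        push_cast; ring
      · push_cast; ring
  · obtain ⟨hm, hrel⟩ := OcfRelHigh.step_shift hα hα2 u v hy hirr
    have y0 : 0 < y := by linarith [hy.1]
    obtain ⟨hx, hinv⟩ := neg_div_facts y0
    have e : ocfD α (-y / (1 + 2 * y)) = 3 := ocfD_eq_of_mem hx.ne (by decide) (by
      rw [hinv]; push_cast; convert hm using 1; ring)
    convert hrel using 1
    simp only [ocfStep, ocfMap_eq hx.ne, e, ocfE_of_neg hx, hinv]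
    push_cast
    refine Prod.ext ?_ (Prod.ext ?_ rfl)
    · simp only
      ring1
    · simp only
      ring1

/-- What the coupling says about the current term of a solution of the recursion. -/
def OcfComparable (g : ℝ) (z z' : ℝ × ℝ × ℝ) : Prop :=
  z.2.1 = z'.2.1 ∨ (z.2.1 = z'.2.1 + 2 * z'.2.2 ∧ g ≤ z'.1) ∨
    (z.2.1 = z'.2.1 - 2 * z'.2.2 ∧ z'.1 ≤ g - 1)

theorem OcfRelLow.comparable {g : ℝ} (hα : g ≤ α) {z z' : ℝ × ℝ × ℝ} (h : OcfRelLow α z z') :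
    OcfComparable g z z' := by
  rcases h with _ | ⟨t, u, v, ht⟩ | _
  · exact Or.inl rfl
  · exact Or.inr (Or.inl ⟨rfl, hα.trans ht.1⟩)
  · exact Or.inl rfl

theorem OcfRelHigh.comparable {g : ℝ} (hα : α ≤ g + 1) {z z' : ℝ × ℝ × ℝ}
    (h : OcfRelHigh α z z') : OcfComparable g z z' := by
  rcases h with _ | ⟨y, u, v, hy⟩ | _ | ⟨y, u, v, hy⟩
  · exact Or.inl rfl
  · exact Or.inr (Or.inr ⟨rfl, by simp only; linarith [hy.2]⟩)
  · exact Or.inl rfl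
  · exact Or.inr (Or.inr ⟨rfl, by simp only; linarith [hy.2]⟩)

theorem iterate_rel {R : ℝ × ℝ × ℝ → ℝ × ℝ × ℝ → Prop}
    (hR : ∀ z z', R z z' → Irrational z'.1 → R (ocfStep α z) (ocfStep 1 z'))
    {z z' : ℝ × ℝ × ℝ} (h : R z z') (hirr : Irrational z'.1) (n : ℕ) :
    R ((ocfStep α)^[n] z) ((ocfStep 1)^[n] z') := by
  induction n with
  | zero => exact h
  | succ n ih =>
    rw [Function.iterate_succ_apply', Function.iterate_succ_apply']
    refine hR _ _ ih ?_
    rw [ocfStep_iterate_fst]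
    exact hirr.ocfMap_iterate n

/-- Every orbit for a parameter in `[g, G]` follows an orbit for the parameter `1`. -/
theorem exists_coupling {g x : ℝ} (hg : 0 < g) (hg2 : g ^ 2 + g = 1) (hα : α ∈ Icc g (g + 1))
    (hx : Irrational x) (hxm : x ∈ ocfInterval α) :
    ∃ t, (t = x ∨ t = x + 2 ∨ t = x - 2) ∧ Irrational t ∧ t ∈ Ico (-1 : ℝ) 1 ∧
      (∀ n, OcfComparable g ((ocfStep α)^[n] (x, 1, 0)) ((ocfStep 1)^[n] (t, 1, 0))) ∧
      ∀ n, OcfComparable g ((ocfStep α)^[n] (x, x, -1)) ((ocfStep 1)^[n] (t, t, -1)) := by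
  have hg3 : 1 / 2 < g := by nlinarith
  rcases le_total α 1 with h | h
  · have hstep : ∀ z z', OcfRelLow α z z' → Irrational z'.1 →
        OcfRelLow α (ocfStep α z) (ocfStep 1 z') :=
      fun z z' hz hz' => hz.step (hg3.trans_le hα.1) h hz'
    rcases lt_or_ge x (-1) with hx1 | hx1
    · have hm : x + 2 ∈ Ico α 1 := ⟨by linarith [hxm.1], by linarith⟩
      have hirr : Irrational (x + 2) := by exact_mod_cast hx.add_intCast 2
      have i1 : OcfRelLow α (x, 1, 0) (x + 2, 1, 0) := by
        convert OcfRelLow.shift (α := α) (x + 2) 1 0 hm using 2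
        · ring
        · congr 1
          ring
      -- With previous term `-1`, the shift turns the initial error `x + 2` back into `x`.
      have i2 : OcfRelLow α (x, x, -1) (x + 2, x + 2, -1) := by
        convert OcfRelLow.shift (α := α) (x + 2) (x + 2) (-1) hm using 2
        · ring
        · congr 1
          ring
      refine ⟨x + 2, by simp, hirr, ⟨by linarith [hm.1, hα.1], hm.2⟩, fun n => ?_, fun n => ?_⟩
      · exact (iterate_rel hstep i1 hirr n).comparable hα.1
      · exact (iterate_rel hstep i2 hirr n).comparable hα.1
    · refine ⟨x, by simp, hx, ⟨hx1, hxm.2.trans_le h⟩, fun n => ?_, fun n => ?_⟩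
      · exact (iterate_rel hstep (OcfRelLow.eq _) hx n).comparable hα.1
      · exact (iterate_rel hstep (OcfRelLow.eq _) hx n).comparable hα.1
  · have hα2 : α * (α - 1) ≤ 1 := by nlinarith [hα.2]
    have hstep : ∀ z z', OcfRelHigh α z z' → Irrational z'.1 →
        OcfRelHigh α (ocfStep α z) (ocfStep 1 z') :=
      fun z z' hz hz' => hz.step h hα2 hz'
    rcases lt_or_ge x 1 with hx1 | hx1
    · refine ⟨x, by simp, hx, ⟨by linarith [hxm.1], hx1⟩, fun n => ?_, fun n => ?_⟩
      · exact (iterate_rel hstep (OcfRelHigh.eq _) hx n).comparable hα.2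
      · exact (iterate_rel hstep (OcfRelHigh.eq _) hx n).comparable hα.2
    · have hm : x ∈ Ico 1 α := ⟨hx1, hxm.2⟩
      have hirr : Irrational (x - 2) := by exact_mod_cast hx.sub_intCast 2
      have i1 : OcfRelHigh α (x, 1, 0) (x - 2, 1, 0) := by
        convert OcfRelHigh.shift (α := α) x 1 0 hm using 2
        congr 1
        ring
      have i2 : OcfRelHigh α (x, x, -1) (x - 2, x - 2, -1) := by
        convert OcfRelHigh.shift (α := α) x (x - 2) (-1) hm using 2
        congr 1
        ring
      refine ⟨x - 2, by simp, hirr, ⟨by linarith, by nlinarith [hm.2]⟩, fun n => ?_, fun n => ?_⟩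
      · exact (iterate_rel hstep i1 hirr n).comparable hα.2
      · exact (iterate_rel hstep i2 hirr n).comparable hα.2

/-- The critical case is `q_n - 2 q_{n-1}`: it occurs at a negative point, where `q_{n-1} ≤ (1 - g)
q_n`, which leaves the positive constant `2g - 1`. -/
theorem OcfComparable.den_bounds {g : ℝ} (hg : 0 < g) {z z' : ℝ × ℝ × ℝ} (h : OcfComparable g z z')
    (hg1 : g < 1) (hs : IsOddDenState g z') :
    (2 * g - 1) * z'.2.1 ≤ z.2.1 ∧ z.2.1 ≤ (1 + 2 / g) * z'.2.1 := by
  have hp := hs.pos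
  have hn := hs.nonneg
  have hv : z'.2.2 ≤ z'.2.1 / g := by
    rw [le_div_iff₀ hg]; linarith [hs.le]
  have hq : 0 < z'.2.1 / g := by positivity
  have e : (1 + 2 / g) * z'.2.1 = z'.2.1 + 2 * (z'.2.1 / g) := by ring
  rw [e]
  rcases h with h | ⟨h, -⟩ | ⟨h, ht⟩
  · rw [h]; constructor <;> nlinarith
  · rw [h]; constructor <;> nlinarith
  · have := hs.le_of_neg (by linarith)
    rw [h]; constructor <;> nlinarith

/-- Since `s_n = -x_n s_{n-1}`, the terms `s_n ± 2 s_{n-1}` are `s_n` times `(2 - |x_n|)/|x_n|` up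
to sign. This factor is at least `1`, and bounded because `|x_n|` is at least `g` or `1 - g`. -/
theorem OcfComparable.abs_bounds {g : ℝ} (hg : 0 < g) {z z' : ℝ × ℝ × ℝ}
    (h : OcfComparable g z z') (hg1 : g < 1) (hm : z'.1 ∈ Ico (-1 : ℝ) 1)
    (hs : z'.2.1 = -z'.1 * z'.2.2) :
    1 * |z'.2.1| ≤ |z.2.1| ∧ |z.2.1| ≤ (2 / g + 2 / (1 - g)) * |z'.2.1| := by
  have k1 : 0 < 1 - g := by linarith
  have c1 : 2 ≤ 2 / g := by rw [le_div_iff₀ hg]; linarith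
  have c2 : 0 < 2 / (1 - g) := by positivity
  have c3 : 0 < 2 / g := by positivity
  have hp := abs_nonneg z'.2.2
  rcases h with h | ⟨h, ht⟩ | ⟨h, ht⟩
  · rw [h]
    have := abs_nonneg z'.2.1
    constructor <;> nlinarith
  · have e1 : |z'.2.1| = z'.1 * |z'.2.2| := by
      rw [hs, abs_mul, abs_neg, abs_of_nonneg (by linarith)]
    have e2 : |z.2.1| = (2 - z'.1) * |z'.2.2| := by
      have : z.2.1 = (2 - z'.1) * z'.2.2 := by rw [h, hs]; ring
      rw [this, abs_mul, abs_of_nonneg (by linarith [hm.2])]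
    rw [e1, e2]
    refine ⟨by nlinarith [hm.2], ?_⟩
    rw [← mul_assoc]
    refine mul_le_mul_of_nonneg_right ?_ hp
    have : 2 ≤ 2 / g * z'.1 := by
      rw [div_mul_eq_mul_div, le_div_iff₀ hg]; linarith
    nlinarith
  · have e1 : |z'.2.1| = -z'.1 * |z'.2.2| := by
      rw [hs, abs_mul, abs_of_nonneg (by linarith)]
    have e2 : |z.2.1| = (2 + z'.1) * |z'.2.2| := by
      have : z.2.1 = -((2 + z'.1) * z'.2.2) := by rw [h, hs]; ring
      rw [this, abs_neg, abs_mul, abs_of_nonneg (by linarith [hm.1])]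
    rw [e1, e2]
    refine ⟨by nlinarith [hm.1], ?_⟩
    rw [← mul_assoc]
    refine mul_le_mul_of_nonneg_right ?_ hp
    have : 2 ≤ 2 / (1 - g) * -z'.1 := by
      rw [div_mul_eq_mul_div, le_div_iff₀ k1]; linarith
    nlinarith [hm.1]

end Coupling

/-! ### Transfer of the exponential rates. -/

section Limits

open Set MeasureTheory Filter Topology

theorem tendsto_div_of_abs_sub_le {a b : ℕ → ℝ} {l C : ℝ}
    (ha : Tendsto (fun n : ℕ => 1 / (n : ℝ) * a n) atTop (𝓝 l)) (h : ∀ n, |b n - a n| ≤ C) :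
    Tendsto (fun n : ℕ => 1 / (n : ℝ) * b n) atTop (𝓝 l) := by
  have h0 : Tendsto (fun n : ℕ => 1 / (n : ℝ) * (b n - a n)) atTop (𝓝 0) := by
    have hC : Tendsto (fun n : ℕ => 1 / (n : ℝ) * C) atTop (𝓝 0) := by
      simpa using tendsto_one_div_atTop_nhds_zero_nat.mul_const C
    refine squeeze_zero_norm (fun n => ?_) hC
    rw [norm_mul, Real.norm_of_nonneg (by positivity : (0 : ℝ) ≤ 1 / n)]
    exact mul_le_mul_of_nonneg_left (h n) (by positivity)
  have := ha.add h0
  rw [add_zero] at this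
  refine this.congr fun n => ?_
  ring

theorem abs_log_sub_log_le {a b c C : ℝ} (hc : 0 < c) (ha : 0 < a) (h1 : c * a ≤ b)
    (h2 : b ≤ C * a) : |Real.log b - Real.log a| ≤ |Real.log c| + |Real.log C| := by
  have hb : 0 < b := lt_of_lt_of_le (by positivity) h1
  have hC : 0 < C := by
    by_contra h
    nlinarith
  have l1 := Real.log_le_log (by positivity) h1
  have l2 := Real.log_le_log hb h2
  rw [Real.log_mul hc.ne' ha.ne'] at l1
  rw [Real.log_mul hC.ne' ha.ne'] at l2
  rw [abs_le]
  constructor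
  · linarith [neg_abs_le (Real.log c), abs_nonneg (Real.log C)]
  · linarith [le_abs_self (Real.log C), abs_nonneg (Real.log c)]

/-- Absorbs an index shift: the Birkhoff sum of length `n + 1` gives `log |s_n|`. -/
theorem tendsto_div_succ {a : ℕ → ℝ} {l : ℝ}
    (ha : Tendsto (fun n : ℕ => 1 / (n : ℝ) * a n) atTop (𝓝 l)) :
    Tendsto (fun n : ℕ => 1 / (n : ℝ) * a (n + 1)) atTop (𝓝 l) := by
  have h1 := (tendsto_add_atTop_iff_nat 1).2 ha
  have h2 : Tendsto (fun n : ℕ => 1 + 1 / (n : ℝ)) atTop (𝓝 1) := by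
    simpa using tendsto_one_div_atTop_nhds_zero_nat.const_add (1 : ℝ)
  have := h2.mul h1
  rw [one_mul] at this
  refine this.congr' ?_
  filter_upwards [eventually_gt_atTop 0] with n hn
  have : (n : ℝ) ≠ 0 := by exact_mod_cast hn.ne'
  push_cast
  field_simp

/-- Convergence of the Birkhoff averages of `log` along the orbit of `|t|`. -/
def HasLogAverage (g t : ℝ) : Prop :=
  Tendsto (fun n : ℕ => (1 / (n : ℝ)) * birkhoffSum oddFold Real.log n |t|) atTop
    (𝓝 (Real.pi ^ 2 / (18 * Real.log g)))

theorem ae_hasLogAverage {g : ℝ} (hg : 0 < g) (hg2 : g ^ 2 + g = 1) :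
    ∀ᵐ t : ℝ, Irrational t → t ∈ Ico (-1 : ℝ) 1 → HasLogAverage g t := by
  have h := ae_tendsto_birkhoffSum_oddFold hg hg2
  have h' := (Measure.measurePreserving_neg (volume : Measure ℝ)).quasiMeasurePreserving.ae h
  filter_upwards [h, h'] with t h1 h2 hirr hm
  have h3 := (mem_oddSet_abs hirr hm).1
  unfold HasLogAverage
  rcases abs_choice t with e | e <;> rw [e] at h3 ⊢
  · exact h1 h3
  · exact h2 h3

section One

variable {g t : ℝ}

theorem HasLogAverage.tendsto_log_abs (h : HasLogAverage g t) (hirr : Irrational t) :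
    Tendsto (fun n : ℕ => (1 / (n : ℝ)) * Real.log |((ocfStep 1)^[n] (t, t, -1)).2.1|) atTop
      (𝓝 (Real.pi ^ 2 / (18 * Real.log g))) := by
  refine (tendsto_div_succ h).congr fun n => ?_
  rw [← log_abs_eq_birkhoffSum hirr, Function.iterate_succ_apply']
  rfl

theorem HasLogAverage.tendsto_log_den (h : HasLogAverage g t) (hg : 0 < g) (hg2 : g ^ 2 + g = 1)
    (hirr : Irrational t) (hm : t ∈ Ico (-1 : ℝ) 1) :
    Tendsto (fun n : ℕ => (1 / (n : ℝ)) * Real.log ((ocfStep 1)^[n] (t, 1, 0)).2.1) atTop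
      (𝓝 (-(Real.pi ^ 2 / (18 * Real.log g)))) := by
  have hg1 : g < 1 := by nlinarith
  have h' : Tendsto (fun n : ℕ => (1 / (n : ℝ)) * -birkhoffSum oddFold Real.log n |t|) atTop
      (𝓝 (-(Real.pi ^ 2 / (18 * Real.log g)))) := by
    refine (Tendsto.neg h).congr fun n => ?_
    ring
  refine tendsto_div_of_abs_sub_le h' (C := |Real.log g| + |Real.log (1 + g⁻¹)|) fun n => ?_
  have hs := (isOddDenState_init hg1 hirr hm).iterate hg hg2 n
  have hdet := ocfStep_iterate_det (α := 1) hirr n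
  have hfst := ocfStep_iterate_fst 1 (t, 1, 0) n
  rw [← log_abs_eq_birkhoffSum hirr, ← Real.log_inv, inv_eq_of_mul_eq_one_right hdet, abs_sub_comm]
  have hT := (mem_oddSet_abs hs.irr hs.mem).1
  have hb := mul_le_add_mul_of_state hg hg1.le hs ⟨hT.1.le, hT.2.le⟩
  have e : ((ocfE ((ocfStep 1)^[n] (t, 1, 0)).1 : ℝ)) * ((ocfStep 1)^[n] (t, 1, 0)).2.2 *
      |((ocfStep 1)^[n] (t, 1, 0)).1| = (ocfMap 1)^[n] t * ((ocfStep 1)^[n] (t, 1, 0)).2.2 := by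
    rw [mul_right_comm, ocfE_mul_abs hs.irr.ne_zero, hfst]
  rw [e] at hb
  exact abs_log_sub_log_le hg hs.pos hb.1 hb.2

end One

theorem HasLogAverage.tendsto_of_coupling {g α x t : ℝ} (h : HasLogAverage g t) (hg : 0 < g)
    (hg2 : g ^ 2 + g = 1) (hx : Irrational x) (hirr : Irrational t) (hm : t ∈ Ico (-1 : ℝ) 1)
    (hq : ∀ n, OcfComparable g ((ocfStep α)^[n] (x, 1, 0)) ((ocfStep 1)^[n] (t, 1, 0)))
    (hδ : ∀ n, OcfComparable g ((ocfStep α)^[n] (x, x, -1)) ((ocfStep 1)^[n] (t, t, -1))) :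
    (∀ n : ℕ, 0 < ocfDen α x n) ∧
      Tendsto (fun n : ℕ => (1 / (n : ℝ)) * Real.log |(ocfDen α x n : ℝ) * x - (ocfNum α x n : ℝ)|)
        atTop (𝓝 (Real.pi ^ 2 / (18 * Real.log g))) ∧
      Tendsto (fun n : ℕ => (1 / (n : ℝ)) * Real.log (ocfDen α x n : ℝ)) atTop
        (𝓝 (-(Real.pi ^ 2 / (18 * Real.log g)))) ∧
      Tendsto (fun n : ℕ => (1 / (n : ℝ)) * Real.log |x - (ocfNum α x n : ℝ) / (ocfDen α x n : ℝ)|)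
        atTop (𝓝 (Real.pi ^ 2 / (9 * Real.log g))) := by
  have hg1 : g < 1 := by nlinarith
  have hgh : 0 < 2 * g - 1 := by nlinarith
  have hs := fun n => (isOddDenState_init hg1 hirr hm).iterate hg hg2 n
  have eq : ∀ n, (ocfDen α x n : ℝ) = ((ocfStep α)^[n] (x, 1, 0)).2.1 := fun n => by
    rw [ocfStep_iterate_snd_fst]; ring
  have eδ : ∀ n, (ocfDen α x n : ℝ) * x - (ocfNum α x n : ℝ) =
      ((ocfStep α)^[n] (x, x, -1)).2.1 := fun n => by
    rw [ocfStep_iterate_snd_fst]; ring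
  have bq := fun n => (hq n).den_bounds hg hg1 (hs n)
  have bδ := fun n => (hδ n).abs_bounds hg hg1
    (by
      have := (hs n).mem
      rw [ocfStep_iterate_fst] at this ⊢
      exact this)
    (ocfStep_iterate_neg_mul hirr n)
  have hpos : ∀ n, (0 : ℝ) < ocfDen α x n := fun n => by
    rw [eq]
    exact lt_of_lt_of_le (mul_pos hgh (hs n).pos) (bq n).1
  have hδne : ∀ n, (ocfDen α x n : ℝ) * x - (ocfNum α x n : ℝ) ≠ 0 := fun n h0 => by
    have hd : (0 : ℤ) < ocfDen α x n := by exact_mod_cast hpos n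
    exact ((hx.intCast_mul hd.ne').sub_intCast (ocfNum α x n)).ne_zero h0
  have hδ1 : ∀ n, 0 < |((ocfStep 1)^[n] (t, t, -1)).2.1| := fun n => by
    refine lt_of_le_of_ne (abs_nonneg _) fun h0 => ?_
    have h2 := (bδ n).2
    rw [← h0, mul_zero, ← eδ] at h2
    exact hδne n (abs_eq_zero.1 (le_antisymm h2 (abs_nonneg _)))
  have lδ : Tendsto (fun n : ℕ => (1 / (n : ℝ)) *
      Real.log |(ocfDen α x n : ℝ) * x - (ocfNum α x n : ℝ)|)
        atTop (𝓝 (Real.pi ^ 2 / (18 * Real.log g))) := by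
    refine tendsto_div_of_abs_sub_le (h.tendsto_log_abs hirr)
      (C := |Real.log 1| + |Real.log (2 / g + 2 / (1 - g))|) fun n => ?_
    rw [eδ]
    exact abs_log_sub_log_le one_pos (hδ1 n) (bδ n).1 (bδ n).2
  have lq : Tendsto (fun n : ℕ => (1 / (n : ℝ)) * Real.log (ocfDen α x n : ℝ)) atTop
      (𝓝 (-(Real.pi ^ 2 / (18 * Real.log g)))) := by
    refine tendsto_div_of_abs_sub_le (h.tendsto_log_den hg hg2 hirr hm)
      (C := |Real.log (2 * g - 1)| + |Real.log (1 + 2 / g)|) fun n => ?_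
    rw [eq]
    exact abs_log_sub_log_le hgh (hs n).pos (bq n).1 (bq n).2
  refine ⟨fun n => by exact_mod_cast hpos n, lδ, lq, ?_⟩
  have hlim := lδ.sub lq
  have e : Real.pi ^ 2 / (18 * Real.log g) - -(Real.pi ^ 2 / (18 * Real.log g)) =
      Real.pi ^ 2 / (9 * Real.log g) := by
    have := (Real.log_neg hg hg1).ne
    field_simp
    norm_num
  rw [e] at hlim
  refine hlim.congr fun n => ?_
  have e2 : x - (ocfNum α x n : ℝ) / (ocfDen α x n : ℝ) =
      ((ocfDen α x n : ℝ) * x - (ocfNum α x n : ℝ)) / ocfDen α x n := by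
    have := (hpos n).ne'
    field_simp
  rw [e2, abs_div, abs_of_pos (hpos n),
    Real.log_div (abs_ne_zero.2 (hδne n)) (hpos n).ne']
  ring

end Limits

theorem corollary19 (α : ℝ) (hα : α ∈ Set.Icc ((√5 - 1) / 2) ((√5 + 1) / 2)) :
    ∀ᵐ x ∂(MeasureTheory.volume.restrict {x : ℝ | x ∈ ocfInterval α ∧ Irrational x}),
      (∀ n : ℕ, 0 < ocfDen α x n) ∧
      Filter.Tendsto
        (fun n : ℕ => (1 / (n : ℝ)) * Real.log |(ocfDen α x n : ℝ) * x - (ocfNum α x n : ℝ)|)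
        Filter.atTop (nhds (-(Real.pi ^ 2 / (18 * Real.log ((√5 + 1) / 2))))) ∧
      Filter.Tendsto
        (fun n : ℕ => (1 / (n : ℝ)) * Real.log (ocfDen α x n : ℝ))
        Filter.atTop (nhds (Real.pi ^ 2 / (18 * Real.log ((√5 + 1) / 2)))) ∧
      Filter.Tendsto
        (fun n : ℕ => (1 / (n : ℝ)) *
          Real.log |x - (ocfNum α x n : ℝ) / (ocfDen α x n : ℝ)|)
        Filter.atTop (nhds (-(Real.pi ^ 2 / (9 * Real.log ((√5 + 1) / 2))))) := by
  have h5 : √5 ^ 2 = 5 := Real.sq_sqrt (by norm_num)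
  obtain ⟨g, hgdef⟩ : ∃ g : ℝ, g = (√5 - 1) / 2 := ⟨_, rfl⟩
  have hg : 0 < g := by
    have : 1 < √5 := by
      rw [Real.lt_sqrt (by norm_num)]; norm_num
    linarith
  have hg2 : g ^ 2 + g = 1 := by
    rw [hgdef]; linear_combination h5 / 4
  have hG : (√5 + 1) / 2 = g + 1 := by rw [hgdef]; ring
  have hlog : Real.log ((√5 + 1) / 2) = -Real.log g := by
    rw [← Real.log_inv, hG]
    congr 1
    refine eq_inv_of_mul_eq_one_left ?_
    linear_combination hg2
  rw [← hgdef, hG] at hα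
  rw [hlog]
  have e1 : -(Real.pi ^ 2 / (18 * -Real.log g)) = Real.pi ^ 2 / (18 * Real.log g) := by
    rw [mul_neg, div_neg, neg_neg]
  have e2 : Real.pi ^ 2 / (18 * -Real.log g) = -(Real.pi ^ 2 / (18 * Real.log g)) := by
    rw [mul_neg, div_neg]
  have e3 : -(Real.pi ^ 2 / (9 * -Real.log g)) = Real.pi ^ 2 / (9 * Real.log g) := by
    rw [mul_neg, div_neg, neg_neg]
  rw [e1, e2, e3]
  have hS : MeasurableSet {x : ℝ | x ∈ ocfInterval α ∧ Irrational x} :=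
    measurableSet_Ico.inter measurableSet_irrational
  rw [MeasureTheory.ae_restrict_iff' hS]
  have h0 := ae_hasLogAverage hg hg2
  -- The coupled point may be `x + 2` or `x - 2`, so the exceptional null set is also translated by
  -- `2` both ways.
  have hp := (MeasureTheory.measurePreserving_add_right
    (MeasureTheory.volume : MeasureTheory.Measure ℝ) 2).quasiMeasurePreserving.ae h0
  have hn := (MeasureTheory.measurePreserving_sub_right
    (MeasureTheory.volume : MeasureTheory.Measure ℝ) 2).quasiMeasurePreserving.ae h0
  filter_upwards [h0, hp, hn] with x hx0 hxp hxn hx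
  obtain ⟨t, ht, hirr, hm, hq, hδ⟩ := exists_coupling hg hg2 hα hx.2 hx.1
  have hav : HasLogAverage g t := by
    rcases ht with rfl | rfl | rfl
    · exact hx0 hirr hm
    · exact hxp hirr hm
    · exact hxn hirr hm
  exact hav.tendsto_of_coupling hg hg2 hx.2 hirr hm hq hδ
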